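/- Let $V$ be a complex polynomial of degree $N\ge 2$ and $\varphi=\operatorname{Re}V$. For a closed set $F\subset\mathbb C$ let $\mathcal M_1^\varphi(F)$ be the set of Borel probability measures $\mu$ supported on $F$ with $\int\log(1+|x|)\,d\mu(x)<\infty$, with finite logarithmic energy $$I(\mu)=\iint\log\frac1{|x-y|}\,d\mu(x)\,d\mu(y),$$ and with $\varphi\in L^1(\mu)$. For such $\mu$ put $I^\varphi(\mu)=I(\mu)+\int\varphi\,d\mu$, and let $$I^\varphi(F)=\inf_{\mu\in\mathcal M_1^\varphi(F)}I^\varphi(\mu)\in[-\infty,+\infty]\qquad(\inf\emptyset=+\infty).$$ A measure $\mu\in\mathcal M_1^\varphi(F)$ with $I^\varphi(\mu)=I^\varphi(F)$ is called an equilibrium measure of $F$ in the external field $\varphi$. Let $C^2_c$ be the set of compactly supported functions $h:\mathbb C\to\mathbb C$ that are $C^2$ in the real sense. For $h\in C_c^2$ and $t\in\mathbb R$ put $h_t(z)=z+th(z)$, $F^t=h_t(F)$, and let $\mu^t=(h_t)_*\mu$ be the pushforward of $\mu$. Whenever the quantities involved are finite for all small $|t|$ and the limits exist in $\mathbb R$,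 define $$D_hI^\varphi(F)=\lim_{t\to0}\frac{I^\varphi(F^t)-I^\varphi(F)}t,\qquad D_hI^\varphi(\mu)=\lim_{t\to0}\frac{I^\varphi(\mu^t)-I^\varphi(\mu)}t\quad(\mu\in\mathcal M^\varphi_1(\mathbb C)).$$ 1. If $F\subset\mathbb C$ is closed and $-\infty<I^\varphi(F)<+\infty$, then for every $h\in C^2_c$ the derivative $D_hI^\varphi(F)$ exists, and for every equilibrium measure $\mu=\mu^{\varphi,F}$ of $F$ the derivative $D_hI^\varphi(\mu)$ exists and $$D_hI^\varphi(F)=D_hI^\varphi(\mu^{\varphi,F}).$$ 2. Call a closed set $F$ $\varphi$-critical if $D_hI^\varphi(F)$ exists and equals $0$ for every $h\in C^2_c$, and call $\mu\in\mathcal M_1^\varphi(\mathbb C)$ $\varphi$-critical if $D_hI^\varphi(\mu)$ exists and equals $0$ for every $h\in C_c^2$. Then every equilibrium measure of a $\varphi$-critical set is a $\varphi$-critical measure. -/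

import Mathlib

open MeasureTheory Filter Topology

noncomputable section

/-- The external field `φ = Re V` of a complex polynomial `V`. -/
def externalField (V : Polynomial ℂ) (z : ℂ) : ℝ := (V.eval z).re

/-- The logarithmic kernel `log (1 / |x - y|)`, with the value `+∞` on the diagonal. -/
def logKernel (x y : ℂ) : EReal := -ENNReal.log ‖x - y‖ₑ

/-- The logarithmic energy `I(μ) = ∬ log (1 / |x - y|) dμ(x) dμ(y)`, as the integral of the positive
part of the kernel minus the integral of its negative part. For finite measures with
`∫ log (1 + |x|) dμ < ∞` the second integral is finite, and `I(μ)` lies in `(-∞, +∞]`. -/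
def logEnergy (μ : Measure ℂ) : EReal :=
  ((∫⁻ p, (logKernel p.1 p.2).toENNReal ∂(μ.prod μ) : ENNReal) : EReal) -
    ((∫⁻ p, (-logKernel p.1 p.2).toENNReal ∂(μ.prod μ) : ENNReal) : EReal)

/-- The set `M₁(F)` of Borel probability measures on the closed set `F` with
`∫ log (1 + |x|) dμ < ∞`. -/
def logProbMeasures (F : Set ℂ) : Set (Measure ℂ) :=
  {μ | IsProbabilityMeasure μ ∧ μ Fᶜ = 0 ∧ Integrable (fun x : ℂ => Real.log (1 + ‖x‖)) μ}

/-- The set `M₁^φ(F)` of measures in `M₁(F)` with finite logarithmic energy and `φ ∈ L¹(μ)`. -/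
def weightedMeasures (V : Polynomial ℂ) (F : Set ℂ) : Set (Measure ℂ) :=
  {μ | μ ∈ logProbMeasures F ∧ logEnergy μ ≠ ⊥ ∧ logEnergy μ ≠ ⊤ ∧
    Integrable (externalField V) μ}

/-- The weighted energy `I^φ(μ) = I(μ) + ∫ φ dμ`, meaningful for `μ ∈ M₁^φ(ℂ)`. -/
def weightedEnergy (V : Polynomial ℂ) (μ : Measure ℂ) : ℝ :=
  (logEnergy μ).toReal + ∫ x, externalField V x ∂μ

/-- The weighted energy `I^φ(F) = inf {I^φ(μ) | μ ∈ M₁^φ(F)}` of a set, in `[-∞, +∞]`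
(it is `+∞` if `M₁^φ(F)` is empty). -/
def weightedSetEnergy (V : Polynomial ℂ) (F : Set ℂ) : EReal :=
  ⨅ μ ∈ weightedMeasures V F, ((weightedEnergy V μ : ℝ) : EReal)

/-- `μ` is an equilibrium measure of `F` in the external field `φ`: it lies in `M₁^φ(F)` and
attains the infimum that defines `I^φ(F)`. -/
def IsEquilibriumMeasure (V : Polynomial ℂ) (F : Set ℂ) (μ : Measure ℂ) : Prop :=
  μ ∈ weightedMeasures V F ∧ ((weightedEnergy V μ : ℝ) : EReal) = weightedSetEnergy V F

/-- The class `C²_c` of complex-valued `C²` functions (in the real sense) on `ℂ` with compact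
support. -/
def IsTestFunction (h : ℂ → ℂ) : Prop := ContDiff ℝ 2 h ∧ HasCompactSupport h

/-- The variation `h_t(z) = z + t h(z)`. -/
def variation (h : ℂ → ℂ) (t : ℝ) (z : ℂ) : ℂ := z + (t : ℂ) * h z

/-- `D_h I^φ(F)` exists and equals `D`: the energies `I^φ(F)` and `I^φ(h_t(F))`, for small `t`, are
finite, and `(I^φ(h_t(F)) - I^φ(F)) / t → D` as `t → 0`. -/
def HasSetEnergyDeriv (V : Polynomial ℂ) (h : ℂ → ℂ) (F : Set ℂ) (D : ℝ) : Prop :=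
  (weightedSetEnergy V F ≠ ⊥ ∧ weightedSetEnergy V F ≠ ⊤) ∧
  (∀ᶠ t : ℝ in 𝓝 0, weightedSetEnergy V (variation h t '' F) ≠ ⊥ ∧
    weightedSetEnergy V (variation h t '' F) ≠ ⊤) ∧
  Tendsto (fun t : ℝ => ((weightedSetEnergy V (variation h t '' F)).toReal -
    (weightedSetEnergy V F).toReal) / t) (𝓝[≠] 0) (𝓝 D)

/-- `D_h I^φ(μ)` exists and equals `D`: `μ` and the pushforwards `μ^t = (h_t)_* μ`, for small `t`,
lie in `M₁^φ(ℂ)`, and `(I^φ(μ^t) - I^φ(μ)) / t → D` as `t → 0`. -/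
def HasMeasureEnergyDeriv (V : Polynomial ℂ) (h : ℂ → ℂ) (μ : Measure ℂ) (D : ℝ) : Prop :=
  μ ∈ weightedMeasures V Set.univ ∧
  (∀ᶠ t : ℝ in 𝓝 0, μ.map (variation h t) ∈ weightedMeasures V Set.univ) ∧
  Tendsto (fun t : ℝ => (weightedEnergy V (μ.map (variation h t)) - weightedEnergy V μ) / t)
    (𝓝[≠] 0) (𝓝 D)

/-- `F` is a `φ`-critical set: it is closed, and `D_h I^φ(F)` exists and vanishes for every
`h ∈ C²_c`. -/
def IsCriticalSet (V : Polynomial ℂ) (F : Set ℂ) : Prop :=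
  IsClosed F ∧ ∀ h : ℂ → ℂ, IsTestFunction h → HasSetEnergyDeriv V h F 0

/-- `μ` is a `φ`-critical measure: it lies in `M₁^φ(ℂ)`, and `D_h I^φ(μ) = 0` for every
`h ∈ C²_c`. -/
def IsCriticalMeasure (V : Polynomial ℂ) (μ : Measure ℂ) : Prop :=
  μ ∈ weightedMeasures V Set.univ ∧
    ∀ h : ℂ → ℂ, IsTestFunction h → HasMeasureEnergyDeriv V h μ 0

end

/-! Pushing `μ` forward by `h_t` changes its weighted energy by `t * energyVariation V h μ` up to `C
* t ^ 2`, with `C` independent of `μ` (`exists_weightedEnergy_expansion`): the kernel varies by the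
real part of the difference quotient of `h`, the field by `Re (V' h)`. For small `t` the map `h_t`
is a homeomorphism that matches the admissible measures of `F` with those of `F^t`. Hence `I^φ(F^t)`
is, up to `O(t²)`, the infimum over one fixed class of `I^φ(μ) + t * energyVariation V h μ`. For
small `t` only near-minimizers of `I^φ` matter, so the derivative exists once the first variation is
nearly constant on them (`exists_energyVariation_sub_le`). Its limit along minimizing sequences is
the derivative, and at an equilibrium measure it is the value of the first variation.

Near-constancy comes from convexity. The midpoint of two near-minimizers is a competitor, so the
energy of their difference is small (`logEnergySub_le_of_near_minimizer`). That energy is a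
superposition of Gaussian energies (`logEnergySub_eq_integral`), each nonnegative because a Gaussian
is a convolution square. Some Gaussian energy of the difference is therefore small at a scale of any
prescribed order, which controls the integrals of Lipschitz functions in `L²`
(`exists_integral_sub_le_of_logEnergySub_le`).

The difference quotient is not such a function: it may be discontinuous on the diagonal and it
decays slowly. It is truncated. The far error is `O(1/R)`, and the error near the diagonal is
bounded by a Gaussian energy of `μ` itself, which is small for all near-minimizers at once because
they are close to a single reference measure without mass on the diagonal. -/

open scoped NNReal ComplexConjugate

/-! ### Energies as Bochner integrals, and the admissible measures. -/

/-- `logKernel` off the diagonal is the real logarithm. -/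
lemma logKernel_of_ne {x y : ℂ} (h : x ≠ y) : logKernel x y = ((-Real.log ‖x - y‖ : ℝ) : EReal) := by
  have h0 : 0 < ‖x - y‖ := norm_pos_iff.2 (sub_ne_zero.2 h)
  rw [logKernel, ← ofReal_norm, ENNReal.log_ofReal_of_pos h0, EReal.coe_neg]

lemma logKernel_self (x : ℂ) : logKernel x x = ⊤ := by
  simp [logKernel]

lemma measurable_logKernel : Measurable (fun p : ℂ × ℂ => logKernel p.1 p.2) := by
  unfold logKernel
  fun_prop

lemma measurable_log_dist : Measurable (fun p : ℂ × ℂ => Real.log ‖p.1 - p.2‖) := by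
  fun_prop

lemma toENNReal_neg_logKernel (x y : ℂ) :
    (-logKernel x y).toENNReal = ENNReal.ofReal (Real.log ‖x - y‖) := by
  by_cases h : x = y
  · subst h; simp [logKernel_self]
  · rw [logKernel_of_ne h, ← EReal.coe_neg, neg_neg, EReal.real_coe_toENNReal]

lemma toENNReal_logKernel_of_ne {x y : ℂ} (h : x ≠ y) :
    (logKernel x y).toENNReal = ENNReal.ofReal (-Real.log ‖x - y‖) := by
  rw [logKernel_of_ne h, EReal.real_coe_toENNReal]

lemma log_dist_le (x y : ℂ) : Real.log ‖x - y‖ ≤ Real.log (1 + ‖x‖) + Real.log (1 + ‖y‖) := by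
  have hx := norm_nonneg x
  have hy := norm_nonneg y
  rw [← Real.log_mul (by positivity) (by positivity)]
  by_cases h : ‖x - y‖ = 0
  · rw [h, Real.log_zero]
    apply Real.log_nonneg
    nlinarith
  · apply Real.log_le_log (lt_of_le_of_ne (norm_nonneg _) (Ne.symm h))
    have := norm_sub_le x y
    nlinarith

/-- By `|x - y| ≤ (1 + |x|)(1 + |y|)`, the logarithmic moments control the part of the kernel at
infinity, so only the singularity on the diagonal can make an energy infinite. -/
lemma lintegral_log_dist_ne_top {μ ν : Measure ℂ} [IsProbabilityMeasure μ] [IsProbabilityMeasure ν]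
    (hμ : Integrable (fun x : ℂ => Real.log (1 + ‖x‖)) μ)
    (hν : Integrable (fun x : ℂ => Real.log (1 + ‖x‖)) ν) :
    ∫⁻ p, ENNReal.ofReal (Real.log ‖p.1 - p.2‖) ∂(μ.prod ν) ≠ ⊤ := by
  have h1 : Integrable (fun p : ℂ × ℂ => Real.log (1 + ‖p.1‖) + Real.log (1 + ‖p.2‖))
      (μ.prod ν) := (hμ.comp_fst ν).add (hν.comp_snd μ)
  refine ne_top_of_le_ne_top h1.lintegral_lt_top.ne ?_
  exact lintegral_mono fun p => ENNReal.ofReal_le_ofReal (log_dist_le _ _)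

/-- The logarithmic kernel is integrable as soon as its positive part is and the diagonal is null. -/
lemma integrable_log_dist {μ ν : Measure ℂ} [IsProbabilityMeasure μ] [IsProbabilityMeasure ν]
    (hμ : Integrable (fun x : ℂ => Real.log (1 + ‖x‖)) μ)
    (hν : Integrable (fun x : ℂ => Real.log (1 + ‖x‖)) ν)
    (h : ∫⁻ p, (logKernel p.1 p.2).toENNReal ∂(μ.prod ν) ≠ ⊤) :
    Integrable (fun p : ℂ × ℂ => Real.log ‖p.1 - p.2‖) (μ.prod ν) ∧
      ∀ᵐ p ∂(μ.prod ν), p.1 ≠ p.2 := by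
  have hd : ∀ᵐ p ∂(μ.prod ν), p.1 ≠ p.2 := by
    -- The kernel is `⊤` on the diagonal, so a finite integral leaves no mass there.
    have := ae_lt_top (measurable_logKernel.ereal_toENNReal) h
    filter_upwards [this] with p hp hne
    rw [hne, logKernel_self] at hp
    simp at hp
  refine ⟨⟨measurable_log_dist.aestronglyMeasurable, ?_⟩, hd⟩
  rw [hasFiniteIntegral_iff_norm]
  have h2 : ∀ᵐ p ∂(μ.prod ν), ENNReal.ofReal ‖Real.log ‖p.1 - p.2‖‖ =
      (logKernel p.1 p.2).toENNReal + ENNReal.ofReal (Real.log ‖p.1 - p.2‖) := by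
    filter_upwards [hd] with p hp
    rw [toENNReal_logKernel_of_ne hp, Real.norm_eq_abs]
    rcases le_total 0 (Real.log ‖p.1 - p.2‖) with h | h
    · rw [abs_of_nonneg h, ENNReal.ofReal_of_nonpos (neg_nonpos.2 h), zero_add]
    · rw [abs_of_nonpos h, ENNReal.ofReal_of_nonpos h, add_zero]
  rw [lintegral_congr_ae h2, lintegral_add_left measurable_logKernel.ereal_toENNReal]
  exact ENNReal.add_lt_top.2 ⟨h.lt_top, (lintegral_log_dist_ne_top hμ hν).lt_top⟩

/-- The logarithmic energy as a Bochner integral. -/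
lemma logEnergy_eq {μ : Measure ℂ}
    (h : Integrable (fun p : ℂ × ℂ => Real.log ‖p.1 - p.2‖) (μ.prod μ))
    (hd : ∀ᵐ p ∂(μ.prod μ), p.1 ≠ p.2) :
    logEnergy μ = ((-∫ p, Real.log ‖p.1 - p.2‖ ∂(μ.prod μ) : ℝ) : EReal) := by
  have h1 : ∫⁻ p, (logKernel p.1 p.2).toENNReal ∂(μ.prod μ) =
      ∫⁻ p, ENNReal.ofReal (-Real.log ‖p.1 - p.2‖) ∂(μ.prod μ) := by
    apply lintegral_congr_ae
    filter_upwards [hd] with p hp using toENNReal_logKernel_of_ne hp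
  have h3 : ∫⁻ p, ENNReal.ofReal (-Real.log ‖p.1 - p.2‖) ∂(μ.prod μ) ≠ ⊤ :=
    h.neg.lintegral_lt_top.ne
  have h4 : ∫⁻ p, ENNReal.ofReal (Real.log ‖p.1 - p.2‖) ∂(μ.prod μ) ≠ ⊤ :=
    h.lintegral_lt_top.ne
  have h5 := integral_eq_lintegral_pos_part_sub_lintegral_neg_part h.neg
  simp only [Pi.neg_apply, neg_neg] at h5
  rw [logEnergy, h1]
  simp_rw [toENNReal_neg_logKernel]
  rw [← integral_neg, h5, EReal.coe_sub, EReal.coe_ennreal_toReal h3, EReal.coe_ennreal_toReal h4]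

/-- The null diagonal has to be listed separately: `Real.log 0 = 0`, so integrability of the real
logarithm does not see atoms, whereas `logKernel` does. -/
lemma mem_weightedMeasures_iff {V : Polynomial ℂ} {F : Set ℂ} {μ : Measure ℂ} :
    μ ∈ weightedMeasures V F ↔ IsProbabilityMeasure μ ∧ μ Fᶜ = 0 ∧
      Integrable (fun x : ℂ => Real.log (1 + ‖x‖)) μ ∧
      Integrable (fun p : ℂ × ℂ => Real.log ‖p.1 - p.2‖) (μ.prod μ) ∧
      (∀ᵐ p ∂(μ.prod μ), p.1 ≠ p.2) ∧ Integrable (externalField V) μ := by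
  constructor
  · rintro ⟨⟨hp, hF, hl⟩, -, ht, hφ⟩
    have hb := lintegral_log_dist_ne_top hl hl
    have ha : ∫⁻ p, (logKernel p.1 p.2).toENNReal ∂(μ.prod μ) ≠ ⊤ := by
      intro h
      apply ht
      rw [logEnergy, h]
      simp_rw [toENNReal_neg_logKernel]
      rw [← EReal.coe_ennreal_toReal hb, EReal.coe_ennreal_top, EReal.top_sub_coe]
    exact ⟨hp, hF, hl, (integrable_log_dist hl hl ha).1, (integrable_log_dist hl hl ha).2, hφ⟩
  · rintro ⟨hp, hF, hl, hi, hd, hφ⟩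
    refine ⟨⟨hp, hF, hl⟩, ?_, ?_, hφ⟩ <;> rw [logEnergy_eq hi hd]
    · exact EReal.coe_ne_bot _
    · exact EReal.coe_ne_top _

lemma weightedEnergy_eq {V : Polynomial ℂ} {F : Set ℂ} {μ : Measure ℂ}
    (h : μ ∈ weightedMeasures V F) :
    weightedEnergy V μ = -∫ p, Real.log ‖p.1 - p.2‖ ∂(μ.prod μ) + ∫ x, externalField V x ∂μ := by
  obtain ⟨-, -, -, hi, hd, -⟩ := mem_weightedMeasures_iff.1 h
  rw [weightedEnergy, logEnergy_eq hi hd, EReal.toReal_coe]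

/-! ### Gaussian energies and their positivity. -/

lemma integrable_gaussian {b : ℝ} (hb : 0 < b) :
    Integrable (fun z : ℂ => Real.exp (-b * ‖z‖ ^ 2)) := by
  refine Integrable.of_integral_ne_zero ?_
  rw [GaussianFourier.integral_rexp_neg_mul_sq_norm hb]
  have := Real.pi_pos
  positivity

lemma integral_gaussian_norm_sq {b : ℝ} (hb : 0 < b) :
    ∫ z : ℂ, Real.exp (-b * ‖z‖ ^ 2) = Real.pi / b := by
  rw [GaussianFourier.integral_rexp_neg_mul_sq_norm hb, Complex.finrank_real_complex]
  norm_num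

/-- This is the parallelogram law around the midpoint of `x` and `y`. Integrated in `z`, it exhibits
the Gaussian of parameter `s` as an `L²` inner product of Gaussians of parameter `2 * s`. -/
lemma gaussian_mul_gaussian (s : ℝ) (x y z : ℂ) :
    Real.exp (-(2 * s) * ‖x - z‖ ^ 2) * Real.exp (-(2 * s) * ‖y - z‖ ^ 2) =
      Real.exp (-s * ‖x - y‖ ^ 2) * Real.exp (-(4 * s) * ‖z - (x + y) / 2‖ ^ 2) := by
  rw [← Real.exp_add, ← Real.exp_add]
  congr 1
  simp only [Complex.sq_norm, Complex.normSq_apply, Complex.sub_re, Complex.sub_im,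
    Complex.div_ofNat_re, Complex.div_ofNat_im, Complex.add_re, Complex.add_im]
  ring

lemma integrable_gaussian_mul {s : ℝ} (hs : 0 < s) (x y : ℂ) :
    Integrable (fun z : ℂ =>
      Real.exp (-(2 * s) * ‖x - z‖ ^ 2) * Real.exp (-(2 * s) * ‖y - z‖ ^ 2)) := by
  simp_rw [gaussian_mul_gaussian]
  exact ((integrable_gaussian (by positivity : 0 < 4 * s)).comp_sub_right _).const_mul _

lemma integral_gaussian_mul {s : ℝ} (hs : 0 < s) (x y : ℂ) :
    ∫ z : ℂ, Real.exp (-(2 * s) * ‖x - z‖ ^ 2) * Real.exp (-(2 * s) * ‖y - z‖ ^ 2) =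
      Real.pi / (4 * s) * Real.exp (-s * ‖x - y‖ ^ 2) := by
  simp_rw [gaussian_mul_gaussian]
  rw [integral_const_mul, integral_sub_right_eq_self (fun z : ℂ => Real.exp (-(4 * s) * ‖z‖ ^ 2)),
    integral_gaussian_norm_sq (by positivity), mul_comm]

/-- The mutual energy of two measures for the Gaussian kernel. -/
noncomputable def gaussEnergy (s : ℝ) (μ ν : Measure ℂ) : ℝ :=
  ∫ p, Real.exp (-s * ‖p.1 - p.2‖ ^ 2) ∂(μ.prod ν)

/-- The potential of a measure for the Gaussian kernel with parameter `2 * s`. -/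
noncomputable def gaussPotential (s : ℝ) (μ : Measure ℂ) (z : ℂ) : ℝ :=
  ∫ x, Real.exp (-(2 * s) * ‖x - z‖ ^ 2) ∂μ

/-- The Gaussian energy of the signed measure `μ - ν`. -/
noncomputable def gaussEnergySub (s : ℝ) (μ ν : Measure ℂ) : ℝ :=
  gaussEnergy s μ μ + gaussEnergy s ν ν - 2 * gaussEnergy s μ ν

section
variable {μ ν : Measure ℂ} [IsProbabilityMeasure μ] [IsProbabilityMeasure ν]

lemma integrable_gauss_kernel {s : ℝ} (hs : 0 ≤ s) :
    Integrable (fun p : ℂ × ℂ => Real.exp (-s * ‖p.1 - p.2‖ ^ 2)) (μ.prod ν) := by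
  refine Integrable.of_bound (C := 1) (by fun_prop) (ae_of_all _ fun p => ?_)
  rw [Real.norm_eq_abs, Real.abs_exp, Real.exp_le_one_iff]
  have := mul_nonneg hs (sq_nonneg ‖p.1 - p.2‖)
  linarith

lemma integrable_gauss_triple {s : ℝ} (hs : 0 < s) :
    Integrable (fun q : (ℂ × ℂ) × ℂ => Real.exp (-(2 * s) * ‖q.1.1 - q.2‖ ^ 2) *
      Real.exp (-(2 * s) * ‖q.1.2 - q.2‖ ^ 2)) ((μ.prod ν).prod volume) := by
  have hm : Continuous (fun q : (ℂ × ℂ) × ℂ => Real.exp (-(2 * s) * ‖q.1.1 - q.2‖ ^ 2) *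
      Real.exp (-(2 * s) * ‖q.1.2 - q.2‖ ^ 2)) := by fun_prop
  refine (integrable_prod_iff (μ := μ.prod ν) (ν := (volume : Measure ℂ))
    hm.aestronglyMeasurable).2 ?_
  refine ⟨ae_of_all _ fun p => integrable_gaussian_mul hs p.1 p.2, ?_⟩
  simp only [norm_mul, Real.norm_eq_abs, Real.abs_exp]
  simp_rw [integral_gaussian_mul hs]
  exact (integrable_gauss_kernel hs.le).const_mul _

/-- By Fubini the mutual Gaussian energy is, up to a constant, the `L²` inner product of the
potentials; positivity and the triangle inequality follow from this. -/
lemma integral_gaussPotential_mul {s : ℝ} (hs : 0 < s) :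
    Integrable (fun z => gaussPotential s μ z * gaussPotential s ν z) ∧
    ∫ z, gaussPotential s μ z * gaussPotential s ν z = Real.pi / (4 * s) * gaussEnergy s μ ν := by
  have h := integrable_gauss_triple (μ := μ) (ν := ν) hs
  have h1 : ∀ z, ∫ p : ℂ × ℂ, Real.exp (-(2 * s) * ‖p.1 - z‖ ^ 2) *
      Real.exp (-(2 * s) * ‖p.2 - z‖ ^ 2) ∂(μ.prod ν) =
        gaussPotential s μ z * gaussPotential s ν z := fun z =>
    integral_prod_mul (fun x : ℂ => Real.exp (-(2 * s) * ‖x - z‖ ^ 2))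
      (fun x : ℂ => Real.exp (-(2 * s) * ‖x - z‖ ^ 2))
  constructor
  · have := h.integral_prod_right
    simpa only [h1] using this
  · have h2 := integral_integral_swap (f := fun (p : ℂ × ℂ) (z : ℂ) =>
      Real.exp (-(2 * s) * ‖p.1 - z‖ ^ 2) * Real.exp (-(2 * s) * ‖p.2 - z‖ ^ 2)) h
    simp_rw [h1, integral_gaussian_mul hs] at h2
    rw [← h2, integral_const_mul, gaussEnergy]

lemma integral_sq_gaussPotential_sub {s : ℝ} (hs : 0 < s) :
    Integrable (fun z => (gaussPotential s μ z - gaussPotential s ν z) ^ 2) ∧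
    ∫ z, (gaussPotential s μ z - gaussPotential s ν z) ^ 2 =
      Real.pi / (4 * s) * gaussEnergySub s μ ν := by
  obtain ⟨i1, e1⟩ := integral_gaussPotential_mul (μ := μ) (ν := μ) hs
  obtain ⟨i2, e2⟩ := integral_gaussPotential_mul (μ := ν) (ν := ν) hs
  obtain ⟨i3, e3⟩ := integral_gaussPotential_mul (μ := μ) (ν := ν) hs
  have h : (fun z => (gaussPotential s μ z - gaussPotential s ν z) ^ 2) = fun z =>
      gaussPotential s μ z * gaussPotential s μ z + gaussPotential s ν z * gaussPotential s ν z
        - 2 * (gaussPotential s μ z * gaussPotential s ν z) := by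
    ext z; ring
  have i12 : Integrable (fun z => gaussPotential s μ z * gaussPotential s μ z +
    gaussPotential s ν z * gaussPotential s ν z) := i1.add i2
  rw [h]
  refine ⟨i12.sub (i3.const_mul 2), ?_⟩
  rw [integral_sub i12 (i3.const_mul 2), integral_add i1 i2, integral_const_mul, e1, e2, e3,
    gaussEnergySub]
  ring

lemma gaussEnergySub_nonneg {s : ℝ} (hs : 0 < s) : 0 ≤ gaussEnergySub s μ ν := by
  have h := (integral_sq_gaussPotential_sub (μ := μ) (ν := ν) hs).2
  have h1 : 0 ≤ Real.pi / (4 * s) * gaussEnergySub s μ ν := by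
    rw [← h]; exact integral_nonneg fun z => sq_nonneg _
  exact nonneg_of_mul_nonneg_right h1 (by have := Real.pi_pos; positivity)

/-- The square root of the Gaussian energy satisfies the triangle inequality up to constants. -/
lemma gaussEnergy_le {s : ℝ} (hs : 0 < s) :
    gaussEnergy s μ μ ≤ 2 * gaussEnergy s ν ν + 2 * gaussEnergySub s μ ν := by
  obtain ⟨i1, e1⟩ := integral_gaussPotential_mul (μ := μ) (ν := μ) hs
  obtain ⟨i2, e2⟩ := integral_gaussPotential_mul (μ := ν) (ν := ν) hs
  obtain ⟨i3, e3⟩ := integral_sq_gaussPotential_sub (μ := μ) (ν := ν) hs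
  have h : ∫ z, gaussPotential s μ z * gaussPotential s μ z ≤
      ∫ z, (2 * (gaussPotential s ν z * gaussPotential s ν z) +
        2 * (gaussPotential s μ z - gaussPotential s ν z) ^ 2) := by
    refine integral_mono i1 ((i2.const_mul 2).add (i3.const_mul 2)) fun z => ?_
    show gaussPotential s μ z * gaussPotential s μ z ≤
      2 * (gaussPotential s ν z * gaussPotential s ν z) +
        2 * (gaussPotential s μ z - gaussPotential s ν z) ^ 2
    -- With `a`, `b` the two potentials, `2b² + 2(a - b)² - a² = (a - 2b)²`.
    nlinarith [sq_nonneg (gaussPotential s μ z - 2 * gaussPotential s ν z)]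
  rw [integral_add (i2.const_mul 2) (i3.const_mul 2), integral_const_mul, integral_const_mul, e1, e2,
    e3] at h
  have hc : 0 < Real.pi / (4 * s) := by have := Real.pi_pos; positivity
  refine le_of_mul_le_mul_left ?_ hc
  linarith

lemma gaussEnergy_anti {s t : ℝ} (hs : 0 ≤ s) (hst : s ≤ t) :
    gaussEnergy t μ ν ≤ gaussEnergy s μ ν := by
  refine integral_mono (integrable_gauss_kernel (hs.trans hst)) (integrable_gauss_kernel hs) fun p => ?_
  apply Real.exp_le_exp.2
  nlinarith [sq_nonneg ‖p.1 - p.2‖]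

/-- As `s → ∞` the kernel tends to the indicator of the diagonal, which is a null set here;
dominated convergence applies. -/
lemma tendsto_gaussEnergy_atTop (hd : ∀ᵐ p ∂(μ.prod ν), p.1 ≠ p.2) :
    Tendsto (fun s => gaussEnergy s μ ν) atTop (𝓝 0) := by
  have h : Tendsto (fun s : ℝ => ∫ p, Real.exp (-s * ‖p.1 - p.2‖ ^ 2) ∂(μ.prod ν)) atTop
      (𝓝 (∫ _p : ℂ × ℂ, (0 : ℝ) ∂(μ.prod ν))) := by
    refine tendsto_integral_filter_of_dominated_convergence (fun _ => (1 : ℝ))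
      (Eventually.of_forall fun s => by fun_prop) ?_ (integrable_const _) ?_
    · filter_upwards [eventually_ge_atTop (0 : ℝ)] with s hs
      refine ae_of_all _ fun p => ?_
      rw [Real.norm_eq_abs, Real.abs_exp, Real.exp_le_one_iff]
      have := mul_nonneg hs (sq_nonneg ‖p.1 - p.2‖)
      linarith
    · filter_upwards [hd] with p hp
      have h0 : 0 < ‖p.1 - p.2‖ ^ 2 := by
        have := norm_pos_iff.2 (sub_ne_zero.2 hp); positivity
      apply Real.tendsto_exp_atBot.comp
      exact (tendsto_neg_atTop_atBot).atBot_mul_const h0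
  rwa [integral_zero] at h

end

/-! ### The logarithm as a superposition of Gaussians. -/

lemma exp_neg_sub_exp_neg_le {u v s : ℝ} :
    Real.exp (-(u * s)) - Real.exp (-(v * s)) ≤ (v - u) * s * Real.exp (-(u * s)) := by
  have h : Real.exp (-(v * s)) = Real.exp (-(u * s)) * Real.exp (-((v - u) * s)) := by
    rw [← Real.exp_add]; congr 1; ring
  have h1 := Real.add_one_le_exp (-((v - u) * s))
  rw [h]
  nlinarith [Real.exp_pos (-(u * s))]

lemma integrableOn_frullani_exp_of_le {u v : ℝ} (hu : 0 < u) (huv : u ≤ v) :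
    IntegrableOn (fun s : ℝ => s⁻¹ * (Real.exp (-(u * s)) - Real.exp (-(v * s)))) (Set.Ioi 0) := by
  have h1 : IntegrableOn (fun s : ℝ => (v - u) * Real.exp (-u * s)) (Set.Ioi 0) :=
    (integrableOn_exp_mul_Ioi (neg_neg_of_pos hu) 0).const_mul _
  refine Integrable.mono' h1 (Measurable.aestronglyMeasurable (by fun_prop)) ?_
  filter_upwards [ae_restrict_mem measurableSet_Ioi] with s hs
  have hs : 0 < s := hs
  have h2 : 0 ≤ Real.exp (-(u * s)) - Real.exp (-(v * s)) := by
    rw [sub_nonneg]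
    apply Real.exp_le_exp.2
    nlinarith
  rw [Real.norm_of_nonneg (mul_nonneg (inv_nonneg.2 hs.le) h2)]
  have h3 := mul_le_mul_of_nonneg_left (exp_neg_sub_exp_neg_le (u := u) (v := v) (s := s))
    (inv_nonneg.2 hs.le)
  refine h3.trans_eq ?_
  rw [neg_mul]
  field_simp

/-- Frullani's integral for the exponential function, with integrability. -/
lemma frullani_exp {a : ℝ} (ha : 0 < a) :
    IntegrableOn (fun s : ℝ => s⁻¹ * (Real.exp (-(a * s)) - Real.exp (-s))) (Set.Ioi 0) ∧
    ∫ s in Set.Ioi (0 : ℝ), s⁻¹ * (Real.exp (-(a * s)) - Real.exp (-s)) = -Real.log a ∧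
    ∫ s in Set.Ioi (0 : ℝ), ‖s⁻¹ * (Real.exp (-(a * s)) - Real.exp (-s))‖ = |Real.log a| := by
  have hi : IntegrableOn (fun s : ℝ => s⁻¹ * (Real.exp (-(a * s)) - Real.exp (-s))) (Set.Ioi 0) := by
    rcases le_total a 1 with h | h
    · simpa using integrableOn_frullani_exp_of_le ha h
    · refine (integrableOn_frullani_exp_of_le one_pos h).neg.congr_fun (fun s _ => ?_)
        measurableSet_Ioi
      simp only [Pi.neg_apply, one_mul]
      ring
  have he : ∫ s in Set.Ioi (0 : ℝ), s⁻¹ * (Real.exp (-(a * s)) - Real.exp (-s)) = -Real.log a := by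
    have h := Frullani.integral_Ioi_eq (f := fun x : ℝ => Real.exp (-x)) (L := 1) (R := 0)
      (a := a) (b := 1)
      ((Continuous.locallyIntegrable (by fun_prop)).locallyIntegrableOn _) ha one_pos ?_ ?_
      (by simpa using hi)
    · simpa using h
    · have : Continuous fun x : ℝ => Real.exp (-x) := by fun_prop
      simpa using (this.tendsto 0).mono_left (nhdsWithin_le_nhds (s := Set.Ioi 0))
    · exact Real.tendsto_exp_atBot.comp tendsto_neg_atTop_atBot
  refine ⟨hi, he, ?_⟩
  rcases le_total a 1 with h | h
  · rw [abs_of_nonpos (Real.log_nonpos ha.le h), ← he]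
    refine setIntegral_congr_fun measurableSet_Ioi fun s hs => Real.norm_of_nonneg ?_
    have hs : 0 < s := hs
    refine mul_nonneg (inv_nonneg.2 hs.le) (sub_nonneg.2 (Real.exp_le_exp.2 ?_))
    nlinarith
  · rw [abs_of_nonneg (Real.log_nonneg h), ← neg_neg (Real.log a), ← he, ← integral_neg]
    refine setIntegral_congr_fun measurableSet_Ioi fun s hs => Real.norm_of_nonpos ?_
    have hs : 0 < s := hs
    refine mul_nonpos_of_nonneg_of_nonpos (inv_nonneg.2 hs.le)
      (sub_nonpos.2 (Real.exp_le_exp.2 ?_))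
    nlinarith

/-- The logarithm as a superposition of Gaussians. -/
lemma log_eq_integral_gaussian {r : ℝ} (hr : 0 < r) :
    IntegrableOn (fun s : ℝ => (2 * s)⁻¹ * (Real.exp (-s * r ^ 2) - Real.exp (-s))) (Set.Ioi 0) ∧
    ∫ s in Set.Ioi (0 : ℝ), (2 * s)⁻¹ * (Real.exp (-s * r ^ 2) - Real.exp (-s)) = -Real.log r ∧
    ∫ s in Set.Ioi (0 : ℝ), ‖(2 * s)⁻¹ * (Real.exp (-s * r ^ 2) - Real.exp (-s))‖ =
      |Real.log r| := by
  obtain ⟨h1, h2, h3⟩ := frullani_exp (a := r ^ 2) (by positivity)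
  have h : (fun s : ℝ => (2 * s)⁻¹ * (Real.exp (-s * r ^ 2) - Real.exp (-s))) =
      fun s : ℝ => 2⁻¹ * (s⁻¹ * (Real.exp (-(r ^ 2 * s)) - Real.exp (-s))) := by
    ext s
    rw [mul_inv, mul_assoc, neg_mul, mul_comm s (r ^ 2)]
  rw [Real.log_pow] at h2 h3
  refine ⟨by rw [h]; exact h1.const_mul _, ?_, ?_⟩
  · rw [h, integral_const_mul, h2]
    push_cast; ring
  · simp_rw [fun s => congrFun h s, norm_mul (2⁻¹ : ℝ)]
    rw [integral_const_mul, h3, abs_mul]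
    norm_num
    ring

lemma lintegral_exp_neg_Ioi : ∫⁻ s in Set.Ioi (0 : ℝ), ENNReal.ofReal (Real.exp (-s)) = 1 := by
  have h := integrableOn_exp_mul_Ioi (a := -1) (by norm_num) 0
  have h2 := integral_exp_mul_Ioi (a := -1) (by norm_num) 0
  simp only [neg_mul, one_mul] at h h2
  rw [← ofReal_integral_eq_lintegral_ofReal h (ae_of_all _ fun s => (Real.exp_pos _).le), h2]
  simp

lemma ofReal_neg_log_eq_lintegral {r : ℝ} (hr : 0 < r) (hr1 : r ≤ 1) :
    ENNReal.ofReal (-Real.log r) = ∫⁻ s in Set.Ioi (0 : ℝ),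
      ENNReal.ofReal ((2 * s)⁻¹ * (Real.exp (-s * r ^ 2) - Real.exp (-s))) := by
  obtain ⟨h1, h2, -⟩ := log_eq_integral_gaussian hr
  rw [← h2, ofReal_integral_eq_lintegral_ofReal h1]
  filter_upwards [ae_restrict_mem measurableSet_Ioi] with s hs
  have hs : 0 < s := hs
  refine mul_nonneg (by positivity) (sub_nonneg.2 (Real.exp_le_exp.2 ?_))
  have : r ^ 2 ≤ 1 := by nlinarith
  nlinarith

/-- The tail `s > 1` of the Gaussian representation captures the singular part of the logarithm up
to an additive constant (the converse is `lintegral_gaussian_tail_le`). Its integrand is positive,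
so finiteness can be tested with `lintegral` before any integrability is known. -/
lemma ofReal_neg_log_le {r : ℝ} (hr : 0 < r) :
    ENNReal.ofReal (-Real.log r) ≤
      (∫⁻ s in Set.Ioi (1 : ℝ), ENNReal.ofReal ((2 * s)⁻¹ * Real.exp (-s * r ^ 2))) + 1 := by
  rcases le_total 1 r with h | h
  · rw [ENNReal.ofReal_of_nonpos (neg_nonpos.2 (Real.log_nonneg h))]
    exact zero_le
  rw [ofReal_neg_log_eq_lintegral hr h, ← Set.Ioc_union_Ioi_eq_Ioi (zero_le_one (α := ℝ)),
    lintegral_union measurableSet_Ioi (Set.Ioc_disjoint_Ioi le_rfl), add_comm]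
  gcongr ?_ + ?_
  · refine setLIntegral_mono' measurableSet_Ioi fun s hs => ENNReal.ofReal_le_ofReal ?_
    have hs : 1 < s := hs
    exact mul_le_mul_of_nonneg_left (sub_le_self _ (Real.exp_pos _).le) (by positivity)
  · calc _ ≤ ∫⁻ s in Set.Ioc (0 : ℝ) 1, 1 := by
          refine setLIntegral_mono' measurableSet_Ioc fun s hs => ?_
          rw [ENNReal.ofReal_le_one]
          have hs0 : 0 < s := hs.1
          have h1 : Real.exp (-s * r ^ 2) ≤ 1 := Real.exp_le_one_iff.2 (by nlinarith [sq_nonneg r])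
          have h2 := Real.add_one_le_exp (-s)
          rw [inv_mul_le_iff₀ (by positivity)]
          linarith
      _ = 1 := by simp

lemma lintegral_gaussian_tail_le {r : ℝ} (hr : 0 < r) :
    ∫⁻ s in Set.Ioi (1 : ℝ), ENNReal.ofReal ((2 * s)⁻¹ * Real.exp (-s * r ^ 2)) ≤
      ENNReal.ofReal (-Real.log r) + 1 := by
  rw [← lintegral_exp_neg_Ioi]
  rcases le_total 1 r with h | h
  · refine le_add_left ?_
    refine (setLIntegral_mono' measurableSet_Ioi fun s hs => ENNReal.ofReal_le_ofReal ?_).trans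
      (lintegral_mono_set (Set.Ioi_subset_Ioi zero_le_one))
    have hs : 1 < s := hs
    have h1 : (2 * s)⁻¹ ≤ 1 := inv_le_one_of_one_le₀ (by linarith)
    have h2 : Real.exp (-s * r ^ 2) ≤ Real.exp (-s) := Real.exp_le_exp.2 (by
      have : 1 ≤ r ^ 2 := by nlinarith
      nlinarith)
    have h3 : 0 < (2 * s)⁻¹ := by positivity
    nlinarith [Real.exp_pos (-s * r ^ 2)]
  · rw [ofReal_neg_log_eq_lintegral hr h, ← lintegral_add_right _ (by fun_prop)]
    refine (setLIntegral_mono' measurableSet_Ioi fun s hs => ?_).trans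
      (lintegral_mono_set (Set.Ioi_subset_Ioi zero_le_one))
    have hs : 1 < s := hs
    have h1 : (2 * s)⁻¹ ≤ 1 := inv_le_one_of_one_le₀ (by linarith)
    have h3 : 0 < (2 * s)⁻¹ := by positivity
    refine le_trans (ENNReal.ofReal_le_ofReal ?_) ENNReal.ofReal_add_le
    nlinarith [Real.exp_pos (-s)]

/-! ### Mutual logarithmic energies and the energy of a difference. -/

/-- The mutual logarithmic energy of two measures, as a Bochner integral. -/
noncomputable def mutualLogEnergy (μ ν : Measure ℂ) : ℝ :=
  -∫ p, Real.log ‖p.1 - p.2‖ ∂(μ.prod ν)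

/-- The logarithmic energy of the signed measure `μ - ν`. -/
noncomputable def logEnergySub (μ ν : Measure ℂ) : ℝ :=
  mutualLogEnergy μ μ + mutualLogEnergy ν ν - 2 * mutualLogEnergy μ ν

lemma mutualLogEnergy_comm (μ ν : Measure ℂ) [SFinite μ] [SFinite ν] :
    mutualLogEnergy μ ν = mutualLogEnergy ν μ := by
  rw [mutualLogEnergy, mutualLogEnergy, ← integral_prod_swap]
  simp [norm_sub_rev]

/-- If `ν × ν` does not charge the diagonal then `ν` has no atoms, and the slices of the diagonal
are single points. -/
lemma ae_ne_prod {μ ν : Measure ℂ} [IsProbabilityMeasure ν] (hν : ∀ᵐ p ∂(ν.prod ν), p.1 ≠ p.2) : ∀ᵐ p ∂(μ.prod ν), p.1 ≠ p.2 := by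
  have hm : MeasurableSet {p : ℂ × ℂ | p.1 = p.2} := measurableSet_eq_fun (by fun_prop) (by fun_prop)
  have h0 : ∀ x, ν {x} = 0 := by
    intro x
    have h1 : (ν.prod ν) ({x} ×ˢ {x}) = 0 := by
      refine measure_mono_null ?_ (ae_iff.1 hν)
      rintro ⟨a, b⟩ ⟨ha, hb⟩
      simp_all
    rw [Measure.prod_prod] at h1
    simpa using h1
  rw [ae_iff]
  simp only [ne_eq, not_not]
  rw [Measure.measure_prod_null hm]
  refine ae_of_all _ fun x => ?_
  have : Prod.mk x ⁻¹' {p : ℂ × ℂ | p.1 = p.2} = {x} := by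
    ext y; simp [eq_comm]
  exact (congrArg ν this).trans (h0 x)

section
variable {μ ν : Measure ℂ} [IsProbabilityMeasure μ] [IsProbabilityMeasure ν]

lemma measurable_gaussEnergy : Measurable (fun s => gaussEnergy s μ ν) := by
  have h : StronglyMeasurable (fun q : ℝ × (ℂ × ℂ) => Real.exp (-q.1 * ‖q.2.1 - q.2.2‖ ^ 2)) :=
    Measurable.stronglyMeasurable (by fun_prop)
  exact (h.integral_prod_right' (ν := μ.prod ν)).measurable

lemma lintegral_gaussian_tail_prod :
    ∫⁻ p, (∫⁻ s in Set.Ioi (1 : ℝ), ENNReal.ofReal ((2 * s)⁻¹ * Real.exp (-s * ‖p.1 - p.2‖ ^ 2)))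
      ∂(μ.prod ν) = ∫⁻ s in Set.Ioi (1 : ℝ), ENNReal.ofReal ((2 * s)⁻¹ * gaussEnergy s μ ν) := by
  rw [lintegral_lintegral_swap (Measurable.aemeasurable (by fun_prop))]
  refine setLIntegral_congr_fun measurableSet_Ioi fun s hs => ?_
  have hs : 0 < s := zero_lt_one.trans hs
  rw [gaussEnergy, ← integral_const_mul, ofReal_integral_eq_lintegral_ofReal
    ((integrable_gauss_kernel hs.le).const_mul _)
    (ae_of_all _ fun p => by positivity)]

/-- Positivity of the Gaussian energy at each `s` gives `2⟨μ, ν⟩ ≤ ⟨μ, μ⟩ + ⟨ν, ν⟩`. This makes the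
mutual energy finite. -/
lemma lintegral_gaussian_tail_add :
    2 * ∫⁻ s in Set.Ioi (1 : ℝ), ENNReal.ofReal ((2 * s)⁻¹ * gaussEnergy s μ ν) ≤
      (∫⁻ s in Set.Ioi (1 : ℝ), ENNReal.ofReal ((2 * s)⁻¹ * gaussEnergy s μ μ)) +
      ∫⁻ s in Set.Ioi (1 : ℝ), ENNReal.ofReal ((2 * s)⁻¹ * gaussEnergy s ν ν) := by
  have hm : Measurable (fun s : ℝ => ENNReal.ofReal ((2 * s)⁻¹ * gaussEnergy s μ μ)) := by
    have := measurable_gaussEnergy (μ := μ) (ν := μ)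
    fun_prop
  rw [← lintegral_add_left hm, ← lintegral_const_mul' _ _ (by simp)]
  refine setLIntegral_mono' measurableSet_Ioi fun s hs => ?_
  have hs : 0 < s := zero_lt_one.trans hs
  have h := gaussEnergySub_nonneg (μ := μ) (ν := ν) hs
  have h3 : 0 < (2 * s)⁻¹ := by positivity
  refine le_trans ?_ ENNReal.ofReal_add_le
  rw [show (2 : ENNReal) = ENNReal.ofReal 2 by simp, ← ENNReal.ofReal_mul (by norm_num)]
  refine ENNReal.ofReal_le_ofReal ?_
  rw [gaussEnergySub] at h
  nlinarith

lemma lintegral_neg_log_le_tail (hd : ∀ᵐ p ∂(μ.prod ν), p.1 ≠ p.2) :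
    ∫⁻ p, ENNReal.ofReal (-Real.log ‖p.1 - p.2‖) ∂(μ.prod ν) ≤
      (∫⁻ s in Set.Ioi (1 : ℝ), ENNReal.ofReal ((2 * s)⁻¹ * gaussEnergy s μ ν)) + 1 := by
  rw [← lintegral_gaussian_tail_prod]
  refine (lintegral_mono_ae (hd.mono fun p hp =>
    ofReal_neg_log_le (norm_pos_iff.2 (sub_ne_zero.2 hp)))).trans ?_
  rw [lintegral_add_right _ measurable_const]
  simp

lemma lintegral_tail_le_neg_log (hd : ∀ᵐ p ∂(μ.prod ν), p.1 ≠ p.2) :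
    (∫⁻ s in Set.Ioi (1 : ℝ), ENNReal.ofReal ((2 * s)⁻¹ * gaussEnergy s μ ν)) ≤
      (∫⁻ p, ENNReal.ofReal (-Real.log ‖p.1 - p.2‖) ∂(μ.prod ν)) + 1 := by
  rw [← lintegral_gaussian_tail_prod]
  refine (lintegral_mono_ae (hd.mono fun p hp =>
    lintegral_gaussian_tail_le (norm_pos_iff.2 (sub_ne_zero.2 hp)))).trans ?_
  rw [lintegral_add_right _ measurable_const]
  simp

/-- The mutual energy of measures of finite energy is finite. -/
lemma integrable_log_dist_prod
    (hμl : Integrable (fun x : ℂ => Real.log (1 + ‖x‖)) μ)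
    (hνl : Integrable (fun x : ℂ => Real.log (1 + ‖x‖)) ν)
    (hμ : Integrable (fun p : ℂ × ℂ => Real.log ‖p.1 - p.2‖) (μ.prod μ))
    (hν : Integrable (fun p : ℂ × ℂ => Real.log ‖p.1 - p.2‖) (ν.prod ν))
    (hμd : ∀ᵐ p ∂(μ.prod μ), p.1 ≠ p.2) (hνd : ∀ᵐ p ∂(ν.prod ν), p.1 ≠ p.2) :
    Integrable (fun p : ℂ × ℂ => Real.log ‖p.1 - p.2‖) (μ.prod ν) := by
  have hd : ∀ᵐ p ∂(μ.prod ν), p.1 ≠ p.2 := ae_ne_prod hνd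
  have h1 := lintegral_tail_le_neg_log hμd
  have h2 := lintegral_tail_le_neg_log hνd
  have h3 := lintegral_gaussian_tail_add (μ := μ) (ν := ν)
  have h4 := lintegral_neg_log_le_tail hd
  have h5 := hμ.neg.lintegral_lt_top
  have h6 := hν.neg.lintegral_lt_top
  simp only [Pi.neg_apply] at h5 h6
  refine (integrable_log_dist hμl hνl ?_).1
  rw [lintegral_congr_ae (hd.mono fun p hp => toENNReal_logKernel_of_ne hp)]
  have h7 : (∫⁻ s in Set.Ioi (1 : ℝ), ENNReal.ofReal ((2 * s)⁻¹ * gaussEnergy s μ ν)) < ⊤ := by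
    refine lt_of_le_of_lt ?_ ((h3.trans (add_le_add h1 h2)).trans_lt (by finiteness))
    exact le_mul_of_one_le_left' one_le_two
  exact (h4.trans_lt (ENNReal.add_lt_top.2 ⟨h7, by simp⟩)).ne

/-- The mutual logarithmic energy as a superposition of Gaussian energies. -/
lemma mutualLogEnergy_eq_integral
    (hi : Integrable (fun p : ℂ × ℂ => Real.log ‖p.1 - p.2‖) (μ.prod ν))
    (hd : ∀ᵐ p ∂(μ.prod ν), p.1 ≠ p.2) :
    IntegrableOn (fun s : ℝ => (2 * s)⁻¹ * (gaussEnergy s μ ν - Real.exp (-s))) (Set.Ioi 0) ∧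
    mutualLogEnergy μ ν =
      ∫ s in Set.Ioi (0 : ℝ), (2 * s)⁻¹ * (gaussEnergy s μ ν - Real.exp (-s)) := by
  have hm : Measurable (fun q : (ℂ × ℂ) × ℝ =>
    (2 * q.2)⁻¹ * (Real.exp (-q.2 * ‖q.1.1 - q.1.2‖ ^ 2) - Real.exp (-q.2))) := by fun_prop
  have hd' : ∀ᵐ p ∂(μ.prod ν), 0 < ‖p.1 - p.2‖ :=
    hd.mono fun p hp => norm_pos_iff.2 (sub_ne_zero.2 hp)
  have hI : Integrable (fun q : (ℂ × ℂ) × ℝ =>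
      (2 * q.2)⁻¹ * (Real.exp (-q.2 * ‖q.1.1 - q.1.2‖ ^ 2) - Real.exp (-q.2)))
      ((μ.prod ν).prod (volume.restrict (Set.Ioi 0))) := by
    refine (integrable_prod_iff (μ := μ.prod ν) (ν := (volume : Measure ℝ).restrict (Set.Ioi 0))
      hm.aestronglyMeasurable).2 ⟨?_, ?_⟩
    · filter_upwards [hd'] with p hp using (log_eq_integral_gaussian hp).1
    · refine hi.abs.congr ?_
      filter_upwards [hd'] with p hp using (log_eq_integral_gaussian hp).2.2.symm
  have hs : ∀ s ∈ Set.Ioi (0 : ℝ), ∫ p : ℂ × ℂ,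
      (2 * s)⁻¹ * (Real.exp (-s * ‖p.1 - p.2‖ ^ 2) - Real.exp (-s)) ∂(μ.prod ν) =
      (2 * s)⁻¹ * (gaussEnergy s μ ν - Real.exp (-s)) := by
    intro s hs
    rw [integral_const_mul, integral_sub (integrable_gauss_kernel (le_of_lt hs))
      (integrable_const _), gaussEnergy]
    simp
  constructor
  · exact IntegrableOn.congr_fun hI.integral_prod_right hs measurableSet_Ioi
  · have h := integral_integral_swap (f := fun (p : ℂ × ℂ) (s : ℝ) =>
      (2 * s)⁻¹ * (Real.exp (-s * ‖p.1 - p.2‖ ^ 2) - Real.exp (-s))) hI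
    rw [setIntegral_congr_fun measurableSet_Ioi hs] at h
    rw [← h, mutualLogEnergy, ← integral_neg]
    apply integral_congr_ae
    filter_upwards [hd'] with p hp using (log_eq_integral_gaussian hp).2.1.symm

end

lemma integrable_log_dist_of_mem {V V' : Polynomial ℂ} {F F' : Set ℂ} {μ ν : Measure ℂ}
    (hμ : μ ∈ weightedMeasures V F) (hν : ν ∈ weightedMeasures V' F') :
    Integrable (fun p : ℂ × ℂ => Real.log ‖p.1 - p.2‖) (μ.prod ν) ∧
      ∀ᵐ p ∂(μ.prod ν), p.1 ≠ p.2 := by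
  obtain ⟨_, -, hμl, hμi, hμd, -⟩ := mem_weightedMeasures_iff.1 hμ
  obtain ⟨_, -, hνl, hνi, hνd, -⟩ := mem_weightedMeasures_iff.1 hν
  exact ⟨integrable_log_dist_prod hμl hνl hμi hνi hμd hνd, ae_ne_prod hνd⟩

/-- The logarithmic energy of a neutral measure as a superposition of Gaussian energies. -/
lemma logEnergySub_eq_integral {V V' : Polynomial ℂ} {F F' : Set ℂ} {μ ν : Measure ℂ}
    (hμ : μ ∈ weightedMeasures V F) (hν : ν ∈ weightedMeasures V' F') :
    IntegrableOn (fun s : ℝ => (2 * s)⁻¹ * gaussEnergySub s μ ν) (Set.Ioi 0) ∧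
    logEnergySub μ ν = ∫ s in Set.Ioi (0 : ℝ), (2 * s)⁻¹ * gaussEnergySub s μ ν := by
  have := hμ.1.1
  have := hν.1.1
  obtain ⟨a1, b1⟩ := integrable_log_dist_of_mem hμ hμ
  obtain ⟨a2, b2⟩ := integrable_log_dist_of_mem hν hν
  obtain ⟨a3, b3⟩ := integrable_log_dist_of_mem hμ hν
  obtain ⟨i1, e1⟩ := mutualLogEnergy_eq_integral a1 b1
  obtain ⟨i2, e2⟩ := mutualLogEnergy_eq_integral a2 b2
  obtain ⟨i3, e3⟩ := mutualLogEnergy_eq_integral a3 b3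
  -- The counterterms `exp (-s)` cancel because `μ - ν` has total mass zero.
  have h : (fun s : ℝ => (2 * s)⁻¹ * gaussEnergySub s μ ν) = fun s : ℝ =>
      (2 * s)⁻¹ * (gaussEnergy s μ μ - Real.exp (-s)) +
      (2 * s)⁻¹ * (gaussEnergy s ν ν - Real.exp (-s)) -
      2 * ((2 * s)⁻¹ * (gaussEnergy s μ ν - Real.exp (-s))) := by
    ext s
    rw [gaussEnergySub]
    ring
  have i12 : IntegrableOn (fun s : ℝ => (2 * s)⁻¹ * (gaussEnergy s μ μ - Real.exp (-s)) +
      (2 * s)⁻¹ * (gaussEnergy s ν ν - Real.exp (-s))) (Set.Ioi 0) := i1.add i2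
  rw [h]
  refine ⟨i12.sub (i3.const_mul 2), ?_⟩
  rw [integral_sub i12 (i3.const_mul 2), integral_add i1 i2, integral_const_mul, ← e1, ← e2, ← e3,
    logEnergySub]

/-- If the Gaussian energy exceeded `8 * δ` throughout `[S, 2S]`, the nonnegative integrand of
`logEnergySub_eq_integral` would be at least `2 * δ / S` there, for a total of at least `2 * δ > δ`.
-/
lemma exists_gaussEnergySub_le {V V' : Polynomial ℂ} {F F' : Set ℂ} {μ ν : Measure ℂ}
    (hμ : μ ∈ weightedMeasures V F) (hν : ν ∈ weightedMeasures V' F') {δ S : ℝ} (hδ : 0 < δ)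
    (hS : 0 < S) (h : logEnergySub μ ν ≤ δ) :
    ∃ s ∈ Set.Icc S (2 * S), gaussEnergySub s μ ν ≤ 8 * δ := by
  have := hμ.1.1
  have := hν.1.1
  by_contra! hc
  obtain ⟨hi, he⟩ := logEnergySub_eq_integral hμ hν
  have hsub : Set.Icc S (2 * S) ⊆ Set.Ioi (0 : ℝ) := fun s hs => lt_of_lt_of_le hS hs.1
  have h1 : ∫ s in Set.Icc S (2 * S), (2 * s)⁻¹ * gaussEnergySub s μ ν ≤ logEnergySub μ ν := by
    rw [he]
    refine setIntegral_mono_set hi ?_ hsub.eventuallyLE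
    filter_upwards [ae_restrict_mem measurableSet_Ioi] with s hs
    have hs : 0 < s := hs
    exact mul_nonneg (by positivity) (gaussEnergySub_nonneg hs)
  have h2 : ∫ s in Set.Icc S (2 * S), (2 * δ / S) ≤
      ∫ s in Set.Icc S (2 * S), (2 * s)⁻¹ * gaussEnergySub s μ ν := by
    refine setIntegral_mono_on (by simp) (hi.mono_set hsub) measurableSet_Icc fun s hs => ?_
    have h3 := hc s hs
    have h4 : 0 < s := hsub hs
    rw [inv_mul_eq_div, div_le_div_iff₀ hS (by positivity)]
    have h5 := hs.2
    nlinarith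
  have h3 : ∫ s in Set.Icc S (2 * S), (2 * δ / S) = 2 * δ := by
    rw [setIntegral_const]
    simp only [measureReal_def, Real.volume_Icc, smul_eq_mul]
    rw [ENNReal.toReal_ofReal (by linarith)]
    field_simp
    ring
  linarith

/-! ### Lipschitz test functions against the Gaussian energy. -/

section TestFunctions
variable {μ ν : Measure ℂ} [IsProbabilityMeasure μ] [IsProbabilityMeasure ν]

lemma integral_gaussian_sub {b : ℝ} (hb : 0 < b) (x : ℂ) :
    Integrable (fun z : ℂ => Real.exp (-b * ‖x - z‖ ^ 2)) ∧
    ∫ z : ℂ, Real.exp (-b * ‖x - z‖ ^ 2) = Real.pi / b := by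
  constructor
  · exact (integrable_gaussian hb).comp_sub_left x
  · rw [integral_sub_left_eq_self (fun z : ℂ => Real.exp (-b * ‖z‖ ^ 2)),
      integral_gaussian_norm_sq hb]

/-- Gaussian mollification of a Lipschitz function. -/
lemma abs_sub_gaussian_mollification_le {K : ℝ≥0} {f : ℂ → ℝ} {M : ℝ} (hf : LipschitzWith K f)
    (hM : ∀ x, |f x| ≤ M) {s : ℝ} (hs : 0 < s) (x : ℂ) :
    Integrable (fun z => f z * Real.exp (-(2 * s) * ‖x - z‖ ^ 2)) ∧
    |f x - 2 * s / Real.pi * ∫ z, f z * Real.exp (-(2 * s) * ‖x - z‖ ^ 2)| ≤ 2 * K / √s := by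
  have hpi := Real.pi_pos
  have hsq : 0 < √s := Real.sqrt_pos.2 hs
  obtain ⟨i2, e2⟩ := integral_gaussian_sub (b := 2 * s) (by positivity) x
  obtain ⟨i1, e1⟩ := integral_gaussian_sub (b := s) hs x
  have i3 : Integrable (fun z => f z * Real.exp (-(2 * s) * ‖x - z‖ ^ 2)) :=
    i2.bdd_mul (c := M) hf.continuous.aestronglyMeasurable (ae_of_all _ hM)
  refine ⟨i3, ?_⟩
  have h1 : f x - 2 * s / Real.pi * ∫ z, f z * Real.exp (-(2 * s) * ‖x - z‖ ^ 2) =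
      2 * s / Real.pi * ∫ z, (f x - f z) * Real.exp (-(2 * s) * ‖x - z‖ ^ 2) := by
    simp_rw [sub_mul]
    rw [integral_sub (i2.const_mul _) i3, integral_const_mul, e2]
    field_simp
  rw [h1, abs_mul, abs_of_pos (by positivity)]
  have h2 : |∫ z, (f x - f z) * Real.exp (-(2 * s) * ‖x - z‖ ^ 2)| ≤
      ∫ z, K / √s * Real.exp (-s * ‖x - z‖ ^ 2) := by
    refine norm_integral_le_of_norm_le (f := fun z => (f x - f z) * Real.exp (-(2 * s) * ‖x - z‖ ^ 2))
      (i1.const_mul _) (ae_of_all _ fun z => ?_)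
    have h3 : |f x - f z| ≤ K * ‖x - z‖ := by
      have := hf.dist_le_mul x z
      rwa [Real.dist_eq, dist_eq_norm] at this
    -- The factor `‖x - z‖` from the Lipschitz bound is absorbed by halving the Gaussian parameter,
    -- which yields the rate `1 / √s`.
    have h4 : √s * ‖x - z‖ ≤ Real.exp (s * ‖x - z‖ ^ 2) := by
      have h5 := Real.add_one_le_exp (s * ‖x - z‖ ^ 2)
      have h6 : (√s * ‖x - z‖) ^ 2 = s * ‖x - z‖ ^ 2 := by
        rw [mul_pow, Real.sq_sqrt hs.le]
      nlinarith [sq_nonneg (√s * ‖x - z‖ - 1)]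
    have h7 : Real.exp (-s * ‖x - z‖ ^ 2) =
        Real.exp (s * ‖x - z‖ ^ 2) * Real.exp (-(2 * s) * ‖x - z‖ ^ 2) := by
      rw [← Real.exp_add]; congr 1; ring
    rw [norm_mul, Real.norm_eq_abs, Real.norm_eq_abs, Real.abs_exp, h7, ← mul_assoc]
    refine mul_le_mul_of_nonneg_right (h3.trans ?_) (Real.exp_pos _).le
    rw [div_mul_eq_mul_div, le_div_iff₀ hsq]
    nlinarith [K.coe_nonneg]
  rw [integral_const_mul, e1] at h2
  refine (mul_le_mul_of_nonneg_left h2 (by positivity)).trans_eq ?_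
  field_simp

/-- Fubini moves the mollification from the test function to the measure, where it becomes the
potential. -/
lemma integral_gaussian_mollification {K : ℝ≥0} {f : ℂ → ℝ} {M : ℝ} (hf : LipschitzWith K f)
    (hM : ∀ x, |f x| ≤ M) {s : ℝ} (hs : 0 < s) :
    Integrable (fun x => ∫ z, f z * Real.exp (-(2 * s) * ‖x - z‖ ^ 2)) μ ∧
    Integrable (fun z => f z * gaussPotential s μ z) ∧
    ∫ x, (∫ z, f z * Real.exp (-(2 * s) * ‖x - z‖ ^ 2)) ∂μ = ∫ z, f z * gaussPotential s μ z := by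
  have hg : Integrable (fun q : ℂ × ℂ => Real.exp (-(2 * s) * ‖q.1 - q.2‖ ^ 2))
      (μ.prod (volume : Measure ℂ)) := by
    refine (integrable_prod_iff (Continuous.aestronglyMeasurable (by fun_prop))).2 ⟨?_, ?_⟩
    · exact ae_of_all _ fun x => (integral_gaussian_sub (by positivity) x).1
    · simp only [Real.norm_eq_abs, Real.abs_exp]
      simp_rw [fun x => (integral_gaussian_sub (b := 2 * s) (by positivity) x).2]
      exact integrable_const _
  have hI : Integrable (fun q : ℂ × ℂ => f q.2 * Real.exp (-(2 * s) * ‖q.1 - q.2‖ ^ 2))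
      (μ.prod (volume : Measure ℂ)) :=
    hg.bdd_mul (c := M) (hf.continuous.comp continuous_snd).aestronglyMeasurable
      (ae_of_all _ fun q => hM q.2)
  refine ⟨hI.integral_prod_left, ?_, ?_⟩
  · have := hI.integral_prod_right
    simp only [integral_const_mul] at this
    exact this
  · have := integral_integral_swap (f := fun x z : ℂ => f z * Real.exp (-(2 * s) * ‖x - z‖ ^ 2)) hI
    rw [this]
    simp_rw [integral_const_mul]
    rfl

/-- Integrals of Lipschitz square integrable functions are controlled by the Gaussian energy. -/
lemma abs_integral_sub_integral_le {K : ℝ≥0} {f : ℂ → ℝ} {M : ℝ} (hf : LipschitzWith K f)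
    (hM : ∀ x, |f x| ≤ M) (hf2 : Integrable (fun x => f x ^ 2)) {s τ : ℝ} (hs : 0 < s)
    (hτ : 0 < τ) :
    |∫ x, f x ∂μ - ∫ x, f x ∂ν| ≤
      4 * K / √s + s * τ * (∫ x, f x ^ 2) + gaussEnergySub s μ ν / (4 * τ) := by
  have hpi := Real.pi_gt_three
  have key : ∀ ρ : Measure ℂ, IsProbabilityMeasure ρ →
      |∫ x, f x ∂ρ - 2 * s / Real.pi * ∫ z, f z * gaussPotential s ρ z| ≤ 2 * K / √s := by
    intro ρ hρ
    obtain ⟨i1, -, e⟩ := integral_gaussian_mollification (μ := ρ) hf hM hs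
    have hfi : Integrable f ρ := Integrable.of_bound hf.continuous.aestronglyMeasurable M
      (ae_of_all _ hM)
    rw [← e, ← integral_const_mul, ← integral_sub hfi (i1.const_mul _)]
    refine (norm_integral_le_of_norm_le_const (C := 2 * K / √s) (ae_of_all _ fun x =>
      (Real.norm_eq_abs _).trans_le (abs_sub_gaussian_mollification_le hf hM hs x).2)).trans_eq ?_
    simp
  obtain ⟨-, i1, -⟩ := integral_gaussian_mollification (μ := μ) hf hM hs
  obtain ⟨-, i2, -⟩ := integral_gaussian_mollification (μ := ν) hf hM hs
  obtain ⟨i3, e3⟩ := integral_sq_gaussPotential_sub (μ := μ) (ν := ν) hs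
  have h1 := key μ inferInstance
  have h2 := key ν inferInstance
  -- Young's inequality with weight `τ`, in place of Cauchy–Schwarz.
  have h3 : |(∫ z, f z * gaussPotential s μ z) - ∫ z, f z * gaussPotential s ν z| ≤
      τ / 2 * (∫ x, f x ^ 2) + 1 / (2 * τ) * (Real.pi / (4 * s) * gaussEnergySub s μ ν) := by
    rw [← integral_sub i1 i2, ← e3, ← integral_const_mul, ← integral_const_mul,
      ← integral_add (hf2.const_mul _) (i3.const_mul _)]
    refine norm_integral_le_of_norm_le
      (f := fun z => f z * gaussPotential s μ z - f z * gaussPotential s ν z)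
      ((hf2.const_mul _).add (i3.const_mul _)) (ae_of_all _ fun z => ?_)
    rw [← mul_sub, Real.norm_eq_abs, abs_mul]
    set a := |f z|
    have ha : f z ^ 2 = a ^ 2 := (sq_abs _).symm
    set u := gaussPotential s μ z - gaussPotential s ν z
    have hu : u ^ 2 = |u| ^ 2 := (sq_abs _).symm
    simp only [ha, hu]
    have : τ / 2 * a ^ 2 + 1 / (2 * τ) * |u| ^ 2 - a * |u| = (τ * a - |u|) ^ 2 / (2 * τ) := by
      field_simp; ring
    have h5 : 0 ≤ (τ * a - |u|) ^ 2 / (2 * τ) := by positivity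
    linarith
  have h4 : 2 * s / Real.pi * |(∫ z, f z * gaussPotential s μ z) - ∫ z, f z * gaussPotential s ν z|
      ≤ s * τ * (∫ x, f x ^ 2) + gaussEnergySub s μ ν / (4 * τ) := by
    refine (mul_le_mul_of_nonneg_left h3 (by positivity)).trans ?_
    have h6 : 2 * s / Real.pi * (τ / 2 * (∫ x, f x ^ 2) + 1 / (2 * τ) *
        (Real.pi / (4 * s) * gaussEnergySub s μ ν)) =
        s * τ * (∫ x, f x ^ 2) / Real.pi + gaussEnergySub s μ ν / (4 * τ) := by
      field_simp
    have h7 : 0 ≤ ∫ x, f x ^ 2 := integral_nonneg fun x => sq_nonneg _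
    have h8 : s * τ * (∫ x, f x ^ 2) / Real.pi ≤ s * τ * (∫ x, f x ^ 2) :=
      div_le_self (by positivity) (by linarith)
    linarith
  have h5 : 4 * K / √s = 2 * K / √s + 2 * K / √s := by ring
  rw [← abs_of_pos (show 0 < 2 * s / Real.pi by positivity), ← abs_mul] at h4
  rw [abs_le] at *
  constructor <;> nlinarith
end TestFunctions

lemma measurable_externalField (V : Polynomial ℂ) : Measurable (externalField V) := by
  unfold externalField
  exact Complex.measurable_re.comp V.continuous.measurable

/-! ### Convexity of the weighted energy. -/

section Midpoint
variable {V : Polynomial ℂ} {F : Set ℂ} {μ ν : Measure ℂ}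

/-- The field term is linear and the logarithmic term is a quadratic form, so the parallelogram
identity measures the convexity gap exactly. -/
lemma midpoint_mem_weightedMeasures (hμ : μ ∈ weightedMeasures V F) (hν : ν ∈ weightedMeasures V F) :
    (2⁻¹ : ENNReal) • (μ + ν) ∈ weightedMeasures V F ∧
    weightedEnergy V ((2⁻¹ : ENNReal) • (μ + ν)) =
      (weightedEnergy V μ + weightedEnergy V ν) / 2 - logEnergySub μ ν / 4 := by
  obtain ⟨_, hμF, hμl, hμi, hμd, hμφ⟩ := mem_weightedMeasures_iff.1 hμ
  obtain ⟨_, hνF, hνl, hνi, hνd, hνφ⟩ := mem_weightedMeasures_iff.1 hν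
  obtain ⟨i1, d1⟩ := integrable_log_dist_of_mem hμ hν
  obtain ⟨i2, d2⟩ := integrable_log_dist_of_mem hν hμ
  have hprod : ((2⁻¹ : ENNReal) • (μ + ν)).prod ((2⁻¹ : ENNReal) • (μ + ν)) =
      (2⁻¹ : ENNReal) • (2⁻¹ : ENNReal) • ((μ.prod μ + ν.prod μ) + (μ.prod ν + ν.prod ν)) := by
    rw [Measure.prod_smul_left, Measure.prod_smul_right, Measure.prod_add, Measure.add_prod,
      Measure.add_prod]
  have hi : Integrable (fun p : ℂ × ℂ => Real.log ‖p.1 - p.2‖)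
      ((μ.prod μ + ν.prod μ) + (μ.prod ν + ν.prod ν)) :=
    (hμi.add_measure i2).add_measure (i1.add_measure hνi)
  have hm : (2⁻¹ : ENNReal) • (μ + ν) ∈ weightedMeasures V F := by
    refine mem_weightedMeasures_iff.2 ⟨⟨?_⟩, ?_, ?_, ?_, ?_, ?_⟩
    · simp only [Measure.smul_apply, Measure.add_apply, measure_univ, smul_eq_mul]
      rw [one_add_one_eq_two, ENNReal.inv_mul_cancel (by simp) (by simp)]
    · simp [hμF, hνF]
    · exact (hμl.add_measure hνl).smul_measure (by simp)
    · rw [hprod]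
      exact (hi.smul_measure (by simp)).smul_measure (by simp)
    · rw [hprod]
      refine Measure.ae_smul_measure (Measure.ae_smul_measure ?_ _) _
      rw [ae_add_measure_iff, ae_add_measure_iff, ae_add_measure_iff]
      exact ⟨⟨hμd, d2⟩, d1, hνd⟩
    · exact (hμφ.add_measure hνφ).smul_measure (by simp)
  refine ⟨hm, ?_⟩
  rw [weightedEnergy_eq hm, weightedEnergy_eq hμ, weightedEnergy_eq hν, hprod,
    integral_smul_measure, integral_smul_measure, integral_smul_measure,
    integral_add_measure hμφ hνφ, integral_add_measure (hμi.add_measure i2) (i1.add_measure hνi),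
    integral_add_measure hμi i2, integral_add_measure i1 hνi, logEnergySub]
  have hc := mutualLogEnergy_comm μ ν
  simp only [mutualLogEnergy] at hc ⊢
  simp only [ENNReal.toReal_inv, ENNReal.toReal_ofNat, smul_eq_mul]
  linarith

/-- Measures of nearly minimal weighted energy are close in the energy norm. -/
lemma logEnergySub_le_of_near_minimizer {I δ : ℝ} (hI : weightedSetEnergy V F = (I : EReal))
    (hμ : μ ∈ weightedMeasures V F) (hν : ν ∈ weightedMeasures V F)
    (hμδ : weightedEnergy V μ ≤ I + δ) (hνδ : weightedEnergy V ν ≤ I + δ) :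
    logEnergySub μ ν ≤ 4 * δ := by
  obtain ⟨hm, he⟩ := midpoint_mem_weightedMeasures hμ hν
  have h : (I : EReal) ≤ (weightedEnergy V ((2⁻¹ : ENNReal) • (μ + ν)) : ℝ) := by
    rw [← hI]
    exact iInf₂_le _ hm
  have h' := EReal.coe_le_coe_iff.1 h
  linarith

end Midpoint

/-! ### Transport of admissible measures by homeomorphisms. -/

section Transport
variable {V : Polynomial ℂ} {F : Set ℂ} {μ : Measure ℂ}

lemma integrable_iff_of_bdd_sub {α : Type*} [MeasurableSpace α] {ρ : Measure α} [IsFiniteMeasure ρ]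
    {f g : α → ℝ} (hf : Measurable f) (hg : Measurable g) {c : ℝ}
    (h : ∀ᵐ x ∂ρ, |f x - g x| ≤ c) : Integrable f ρ ↔ Integrable g ρ := by
  have hd : Integrable (fun x => f x - g x) ρ :=
    Integrable.of_bound (hf.sub hg).aestronglyMeasurable c h
  constructor
  · intro hi
    exact (hi.sub hd).congr (ae_of_all _ fun x => by simp)
  · intro hi
    exact (hi.add hd).congr (ae_of_all _ fun x => by simp)

lemma log_one_add_sub_le {a b : ℝ} (ha : 0 ≤ a) (hb : 0 ≤ b) :
    Real.log (1 + a) - Real.log (1 + b) ≤ |a - b| := by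
  rw [← Real.log_div (by positivity) (by positivity)]
  refine (Real.log_le_sub_one_of_pos (by positivity)).trans ?_
  rw [div_sub_one (by positivity), div_le_iff₀ (by positivity)]
  have h1 := le_abs_self (a - b)
  nlinarith [abs_nonneg (a - b)]

lemma abs_log_one_add_sub_le {a b : ℝ} (ha : 0 ≤ a) (hb : 0 ≤ b) :
    |Real.log (1 + a) - Real.log (1 + b)| ≤ |a - b| := by
  rw [abs_le]
  have h1 := log_one_add_sub_le ha hb
  have h2 := log_one_add_sub_le hb ha
  rw [abs_sub_comm] at h2
  constructor <;> linarith

/-- Homeomorphisms that change the kernel and the field by bounded amounts preserve the class of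
admissible measures. -/
lemma map_mem_weightedMeasures_iff (e : ℂ ≃ₜ ℂ) {c : ℝ}
    (hlog : ∀ x y, x ≠ y → |Real.log ‖e x - e y‖ - Real.log ‖x - y‖| ≤ c)
    (he : ∀ x, ‖e x - x‖ ≤ c) (hφ : ∀ x, |externalField V (e x) - externalField V x| ≤ c) :
    μ.map e ∈ weightedMeasures V (e '' F) ↔ μ ∈ weightedMeasures V F := by
  have hem : Measurable e := e.measurable
  by_cases hp : IsProbabilityMeasure μ
  swap
  · refine iff_of_false (fun h => hp ⟨?_⟩) (fun h => hp h.1.1)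
    have := h.1.1.measure_univ
    rwa [Measure.map_apply hem MeasurableSet.univ, Set.preimage_univ] at this
  have hp' : IsProbabilityMeasure (μ.map e) := Measure.isProbabilityMeasure_map hem.aemeasurable
  have hprod : (μ.map e).prod (μ.map e) = (μ.prod μ).map (Prod.map e e) :=
    Measure.map_prod_map _ _ hem hem
  have hee : Measurable (Prod.map e e) := hem.prodMap hem
  have hFc : (μ.map e) (e '' F)ᶜ = μ Fᶜ := by
    rw [← Set.image_compl_eq e.bijective, e.measurableEmbedding.map_apply,
      Set.preimage_image_eq _ e.injective]
  have h1 : Integrable (fun x : ℂ => Real.log (1 + ‖x‖)) (μ.map e) ↔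
      Integrable (fun x : ℂ => Real.log (1 + ‖x‖)) μ := by
    rw [integrable_map_measure (Measurable.aestronglyMeasurable (by fun_prop)) hem.aemeasurable]
    refine integrable_iff_of_bdd_sub (c := c) (Measurable.comp (by fun_prop) hem) (by fun_prop)
      (ae_of_all _ fun x => ?_)
    exact (abs_log_one_add_sub_le (norm_nonneg _) (norm_nonneg _)).trans
      ((abs_norm_sub_norm_le _ _).trans (he x))
  have h2 : (∀ᵐ p ∂((μ.map e).prod (μ.map e)), p.1 ≠ p.2) ↔ ∀ᵐ p ∂(μ.prod μ), p.1 ≠ p.2 := by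
    have hm : MeasurableSet {p : ℂ × ℂ | p.1 ≠ p.2} :=
      (measurableSet_eq_fun measurable_fst measurable_snd).compl
    rw [hprod, ae_map_iff hee.aemeasurable hm]
    simp
  have h3 : Integrable (externalField V) (μ.map e) ↔ Integrable (externalField V) μ := by
    rw [integrable_map_measure (measurable_externalField V).aestronglyMeasurable hem.aemeasurable]
    exact integrable_iff_of_bdd_sub (c := c) ((measurable_externalField V).comp hem)
      (measurable_externalField V) (ae_of_all _ hφ)
  have h4 : (∀ᵐ p ∂(μ.prod μ), p.1 ≠ p.2) →
      (Integrable (fun p : ℂ × ℂ => Real.log ‖p.1 - p.2‖) ((μ.map e).prod (μ.map e)) ↔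
      Integrable (fun p : ℂ × ℂ => Real.log ‖p.1 - p.2‖) (μ.prod μ)) := by
    intro hd
    rw [hprod, integrable_map_measure measurable_log_dist.aestronglyMeasurable hee.aemeasurable]
    exact integrable_iff_of_bdd_sub (c := c) (measurable_log_dist.comp hee) measurable_log_dist
      (hd.mono fun p hp => hlog _ _ hp)
  rw [mem_weightedMeasures_iff, mem_weightedMeasures_iff, hFc, h1, h2, h3]
  constructor
  · rintro ⟨-, a, b, c, d, f⟩
    exact ⟨hp, a, b, (h4 d).1 c, d, f⟩
  · rintro ⟨-, a, b, c, d, f⟩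
    exact ⟨hp', a, b, (h4 d).2 c, d, f⟩

lemma weightedEnergy_map_sub (e : ℂ ≃ₜ ℂ) (hμ : μ ∈ weightedMeasures V F)
    (he : μ.map e ∈ weightedMeasures V (e '' F)) :
    weightedEnergy V (μ.map e) - weightedEnergy V μ =
      -∫ p, (Real.log ‖e p.1 - e p.2‖ - Real.log ‖p.1 - p.2‖) ∂(μ.prod μ) +
        ∫ x, (externalField V (e x) - externalField V x) ∂μ := by
  obtain ⟨_, -, -, i1, -, i2⟩ := mem_weightedMeasures_iff.1 hμ
  obtain ⟨_, -, -, i3, -, i4⟩ := mem_weightedMeasures_iff.1 he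
  have hem : Measurable e := e.measurable
  have hee : Measurable (Prod.map e e) := hem.prodMap hem
  have hprod : (μ.map e).prod (μ.map e) = (μ.prod μ).map (Prod.map e e) :=
    Measure.map_prod_map _ _ hem hem
  rw [weightedEnergy_eq hμ, weightedEnergy_eq he]
  rw [hprod] at i3 ⊢
  rw [integrable_map_measure measurable_log_dist.aestronglyMeasurable hee.aemeasurable] at i3
  rw [integrable_map_measure (measurable_externalField V).aestronglyMeasurable
    hem.aemeasurable] at i4
  rw [integral_map hee.aemeasurable measurable_log_dist.aestronglyMeasurable,
    integral_map hem.aemeasurable (measurable_externalField V).aestronglyMeasurable]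
  have e1 := integral_sub i3 i1
  have e2 := integral_sub i4 i2
  simp only [Function.comp_apply, Prod.map_fst, Prod.map_snd] at e1 e2 ⊢
  rw [e1, e2]
  ring

end Transport

lemma abs_integral_le_of_prob {α : Type*} [MeasurableSpace α] {ρ : Measure α}
    [IsProbabilityMeasure ρ] {f : α → ℝ} {C : ℝ} (h : ∀ᵐ x ∂ρ, |f x| ≤ C) : |∫ x, f x ∂ρ| ≤ C := by
  have h1 := norm_integral_le_of_norm_le_const (μ := ρ) (f := f) (C := C) h
  rwa [probReal_univ, mul_one] at h1

/-! ### First-order expansion of the energy along `h_t`. -/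

/-- The difference quotient of `h`, with the value `0` on the diagonal. -/
noncomputable def diffQuotient (h : ℂ → ℂ) (x y : ℂ) : ℂ := (h x - h y) / (x - y)

/-- The first variation of the weighted energy in the direction `h`. -/
noncomputable def energyVariation (V : Polynomial ℂ) (h : ℂ → ℂ) (μ : Measure ℂ) : ℝ :=
  -∫ p, (diffQuotient h p.1 p.2).re ∂(μ.prod μ) + ∫ x, (V.derivative.eval x * h x).re ∂μ

lemma norm_diffQuotient_le {h : ℂ → ℂ} {L : ℝ≥0} (hL : LipschitzWith L h) (x y : ℂ) :
    ‖diffQuotient h x y‖ ≤ L := by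
  have := hL.dist_le_mul x y
  rw [dist_eq_norm, dist_eq_norm] at this
  rw [diffQuotient, norm_div]
  exact div_le_of_le_mul₀ (norm_nonneg _) L.coe_nonneg this

lemma measurable_diffQuotient {h : ℂ → ℂ} (hh : Continuous h) :
    Measurable (fun p : ℂ × ℂ => diffQuotient h p.1 p.2) := by
  have := hh.measurable
  unfold diffQuotient
  fun_prop

lemma integrable_diffQuotient {h : ℂ → ℂ} {L : ℝ≥0} (hL : LipschitzWith L h) (μ ν : Measure ℂ)
    [IsProbabilityMeasure μ] [IsProbabilityMeasure ν] :
    Integrable (fun p : ℂ × ℂ => (diffQuotient h p.1 p.2).re) (μ.prod ν) :=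
  (Integrable.of_bound (measurable_diffQuotient hL.continuous).aestronglyMeasurable L
    (ae_of_all _ fun p => norm_diffQuotient_le hL p.1 p.2)).re

lemma IsTestFunction.exists_bounds {h : ℂ → ℂ} (hh : IsTestFunction h) :
    ∃ (L : ℝ≥0) (M R : ℝ), 0 ≤ M ∧ LipschitzWith L h ∧ (∀ x, ‖h x‖ ≤ M) ∧
      ∀ x, h x ≠ 0 → ‖x‖ ≤ R := by
  obtain ⟨L, hL⟩ := ContDiff.lipschitzWith_of_hasCompactSupport hh.2 hh.1 (by norm_num)
  obtain ⟨M, hM⟩ := hh.2.exists_bound_of_continuous hh.1.continuous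
  obtain ⟨R, hR⟩ := hh.2.isCompact.isBounded.exists_norm_le
  exact ⟨L, M, R, (norm_nonneg _).trans (hM 0), hL, hM, fun x hx => hR x (subset_tsupport _ hx)⟩

lemma Polynomial.exists_norm_eval_le (P : Polynomial ℂ) (R : ℝ) :
    ∃ C : ℝ, 0 ≤ C ∧ ∀ z : ℂ, ‖z‖ ≤ R → ‖P.eval z‖ ≤ C := by
  obtain ⟨C, hC⟩ := (isCompact_closedBall (0 : ℂ) R).exists_bound_of_continuousOn
    P.continuous.continuousOn
  refine ⟨max C 0, le_max_right _ _, fun z hz => (hC z (by simpa using hz)).trans (le_max_left _ _)⟩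

/-- Second order Taylor bound for a polynomial on a bounded set. -/
lemma Polynomial.exists_taylor_bound (P : Polynomial ℂ) (R : ℝ) :
    ∃ C : ℝ, 0 ≤ C ∧ ∀ z w : ℂ, ‖z‖ ≤ R → ‖w‖ ≤ 1 →
      ‖P.eval (z + w) - P.eval z - P.derivative.eval z * w‖ ≤ C * ‖w‖ ^ 2 := by
  induction P using Polynomial.induction_on with
  | C a => exact ⟨0, le_rfl, fun z w _ _ => by simp⟩
  | add P Q hP hQ =>
    obtain ⟨C, hC0, hC⟩ := hP
    obtain ⟨D, hD0, hD⟩ := hQ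
    refine ⟨C + D, by positivity, fun z w hz hw => ?_⟩
    have h := norm_add_le_of_le (hC z w hz hw) (hD z w hz hw)
    refine le_trans (le_of_eq ?_) (h.trans_eq (by ring))
    congr 1
    simp only [Polynomial.eval_add, Polynomial.derivative_add]
    ring
  | monomial n a hP =>
    obtain ⟨C, hC0, hC⟩ := hP
    set P : Polynomial ℂ := Polynomial.C a * Polynomial.X ^ n with hPdef
    obtain ⟨B, hB0, hB⟩ := P.derivative.exists_norm_eval_le R
    have hX : Polynomial.C a * Polynomial.X ^ (n + 1) = P * Polynomial.X := by
      rw [hPdef]; ring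
    refine ⟨|R| * C + (C + B), by positivity, fun z w hz hw => ?_⟩
    rw [hX]
    simp only [Polynomial.eval_mul, Polynomial.eval_X, Polynomial.derivative_mul,
      Polynomial.derivative_X, Polynomial.eval_add, mul_one]
    set E := P.eval (z + w) - P.eval z - P.derivative.eval z * w with hE
    -- The Taylor remainder of `P * X` is written through the remainder `E` of `P`.
    have h1 : P.eval (z + w) * (z + w) - P.eval z * z - (P.derivative.eval z * z + P.eval z) * w =
        z * E + w * (E + P.derivative.eval z * w) := by
      rw [hE]; ring
    have h2 := hC z w hz hw
    have h3 := hB z hz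
    have hw0 := norm_nonneg w
    have hwsq : 0 ≤ ‖w‖ ^ 2 := by positivity
    rw [h1]
    have h4 : ‖z * E‖ ≤ |R| * (C * ‖w‖ ^ 2) := by
      rw [norm_mul]
      exact mul_le_mul (hz.trans (le_abs_self R)) h2 (norm_nonneg _) (abs_nonneg _)
    have h5 : ‖w * (E + P.derivative.eval z * w)‖ ≤ ‖w‖ * (C * ‖w‖ ^ 2 + B * ‖w‖) := by
      rw [norm_mul]
      refine mul_le_mul_of_nonneg_left (norm_add_le_of_le h2 ?_) hw0
      rw [norm_mul]
      exact mul_le_mul_of_nonneg_right h3 hw0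
    refine (norm_add_le_of_le h4 h5).trans ?_
    have h6 : ‖w‖ * (C * ‖w‖ ^ 2) ≤ 1 * (C * ‖w‖ ^ 2) :=
      mul_le_mul_of_nonneg_right hw (by positivity)
    nlinarith

/-- `h_t` differs from the identity by a Lipschitz map of constant `|t| * L < 1`, so it is globally
invertible. -/
lemma exists_variation_homeomorph {h : ℂ → ℂ} {L : ℝ≥0} (hL : LipschitzWith L h) {t : ℝ}
    (ht : |t| * L < 1) : ∃ e : ℂ ≃ₜ ℂ, ⇑e = variation h t := by
  have ha : ApproximatesLinearOn (variation h t)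
      (ContinuousLinearEquiv.refl ℝ ℂ : ℂ →L[ℝ] ℂ) Set.univ (‖t‖₊ * L) := by
    intro x _ y _
    have h1 : variation h t x - variation h t y - (ContinuousLinearEquiv.refl ℝ ℂ : ℂ →L[ℝ] ℂ) (x - y)
        = t * (h x - h y) := by
      simp [variation]; ring
    have h2 := hL.dist_le_mul x y
    rw [dist_eq_norm, dist_eq_norm] at h2
    rw [h1, norm_mul, Complex.norm_real, NNReal.coe_mul, coe_nnnorm, mul_assoc]
    exact mul_le_mul_of_nonneg_left h2 (norm_nonneg _)
  refine ⟨ha.toHomeomorph _ (Or.inr ?_), rfl⟩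
  have h3 : ‖((ContinuousLinearEquiv.refl ℝ ℂ).symm : ℂ →L[ℝ] ℂ)‖₊ = 1 := by
    rw [← NNReal.coe_inj, coe_nnnorm]
    exact ContinuousLinearMap.norm_id
  rw [h3, inv_one, ← NNReal.coe_lt_coe, NNReal.coe_mul, coe_nnnorm]
  exact ht

lemma abs_log_norm_one_add_sub_re_le {z : ℂ} (hz : ‖z‖ ≤ 1 / 2) :
    |Real.log ‖1 + z‖ - z.re| ≤ ‖z‖ ^ 2 := by
  have h := Complex.norm_log_one_add_sub_self_le (z := z) (by linarith)
  have h1 := (Complex.abs_re_le_norm (Complex.log (1 + z) - z)).trans h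
  rw [Complex.sub_re, Complex.log_re] at h1
  refine h1.trans ?_
  have h2 : (1 - ‖z‖)⁻¹ ≤ 2 := inv_le_of_inv_le₀ (by norm_num) (by linarith)
  nlinarith [sq_nonneg ‖z‖]

/-- The difference of the images is `(x - y) * (1 + t * q)` with `q` the difference quotient; the
bound is the second-order expansion of `log |1 + t * q|`. -/
lemma abs_log_variation_sub_le {h : ℂ → ℂ} {L : ℝ≥0} (hL : LipschitzWith L h) {t : ℝ}
    (ht : |t| * L ≤ 1 / 2) {x y : ℂ} (hxy : x ≠ y) :
    |Real.log ‖variation h t x - variation h t y‖ - Real.log ‖x - y‖ -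
      t * (diffQuotient h x y).re| ≤ (|t| * L) ^ 2 := by
  have h0 : x - y ≠ 0 := sub_ne_zero.2 hxy
  have hn : ‖(t : ℂ) * diffQuotient h x y‖ ≤ |t| * L := by
    rw [norm_mul, Complex.norm_real]
    exact mul_le_mul_of_nonneg_left (norm_diffQuotient_le hL x y) (abs_nonneg t)
  have h1 : variation h t x - variation h t y = (x - y) * (1 + t * diffQuotient h x y) := by
    rw [variation, variation, diffQuotient]
    field_simp
    ring
  have h2 : 1 + (t : ℂ) * diffQuotient h x y ≠ 0 := by
    intro hc
    have h3 : (t : ℂ) * diffQuotient h x y = -1 := by linear_combination hc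
    rw [h3, norm_neg, norm_one] at hn
    linarith
  have h4 := abs_log_norm_one_add_sub_re_le (hn.trans ht)
  rw [h1, norm_mul, Real.log_mul (norm_ne_zero_iff.2 h0) (norm_ne_zero_iff.2 h2)]
  rw [Complex.re_ofReal_mul] at h4
  rw [add_sub_cancel_left]
  exact h4.trans (pow_le_pow_left₀ (norm_nonneg _) hn 2)

/-- First order expansion of the weighted energy along the variation, uniformly in the measure. -/
lemma exists_weightedEnergy_expansion (V : Polynomial ℂ) {h : ℂ → ℂ} (hh : IsTestFunction h) :
    ∃ C t₀ : ℝ, 0 ≤ C ∧ 0 < t₀ ∧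
      (∀ μ : Measure ℂ, IsProbabilityMeasure μ → |energyVariation V h μ| ≤ C) ∧
      ∀ t : ℝ, |t| ≤ t₀ → ∃ e : ℂ ≃ₜ ℂ, ⇑e = variation h t ∧
        ∀ (F : Set ℂ) (μ : Measure ℂ),
          (μ.map e ∈ weightedMeasures V (e '' F) ↔ μ ∈ weightedMeasures V F) ∧
          (μ ∈ weightedMeasures V F →
            |weightedEnergy V (μ.map e) - weightedEnergy V μ - t * energyVariation V h μ| ≤
              C * t ^ 2) := by
  obtain ⟨L, M, R, hM0, hL, hM, hR⟩ := hh.exists_bounds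
  obtain ⟨A, hA0, hA⟩ := V.exists_taylor_bound R
  obtain ⟨B, hB0, hB⟩ := V.derivative.exists_norm_eval_le R
  have hVh : ∀ x, |(V.derivative.eval x * h x).re| ≤ B * M := by
    intro x
    refine (Complex.abs_re_le_norm _).trans ?_
    rw [norm_mul]
    by_cases hx : h x = 0
    · rw [hx, norm_zero, mul_zero]; positivity
    · exact mul_le_mul (hB x (hR x hx)) (hM x) (norm_nonneg _) hB0
  have hVm : Measurable (fun x => (V.derivative.eval x * h x).re) :=
    Complex.measurable_re.comp (V.derivative.continuous.mul hL.continuous).measurable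
  have hφ : ∀ t : ℝ, |t| * M ≤ 1 → ∀ x, |externalField V (variation h t x) - externalField V x -
      t * (V.derivative.eval x * h x).re| ≤ A * M ^ 2 * t ^ 2 := by
    intro t ht x
    by_cases hx : h x = 0
    · simp only [variation, hx, mul_zero, add_zero, sub_self, Complex.zero_re, abs_zero]
      positivity
    have hn : ‖(t : ℂ) * h x‖ ≤ |t| * M := by
      rw [norm_mul, Complex.norm_real]
      exact mul_le_mul_of_nonneg_left (hM x) (abs_nonneg t)
    have h1 := hA x (t * h x) (hR x hx) (hn.trans ht)
    have h2 := (Complex.abs_re_le_norm _).trans h1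
    have h3 : V.derivative.eval x * (t * h x) = t * (V.derivative.eval x * h x) := by ring
    rw [Complex.sub_re, Complex.sub_re, h3, Complex.re_ofReal_mul] at h2
    refine h2.trans ?_
    have h4 : ‖(t : ℂ) * h x‖ ^ 2 ≤ (|t| * M) ^ 2 := pow_le_pow_left₀ (norm_nonneg _) hn 2
    rw [mul_pow, sq_abs] at h4
    nlinarith
  -- `L ^ 2` and `A * M ^ 2` bound the second-order remainders of kernel and field, `L + B * M` the
  -- first variation. The choice of `t₀` gives `|t| * L ≤ 1 / 2` and `|t| * M ≤ 1`.
  refine ⟨(L : ℝ) ^ 2 + A * M ^ 2 + (L + B * M), 1 / (2 * (L + M + 1)), by positivity, by positivity,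
    ?_, ?_⟩
  · intro μ hμ
    have h1 : |∫ p, (diffQuotient h p.1 p.2).re ∂(μ.prod μ)| ≤ L := by
      refine abs_integral_le_of_prob (ae_of_all _ fun p => ?_)
      exact (Complex.abs_re_le_norm _).trans (norm_diffQuotient_le hL _ _)
    have h2 : |∫ x, (V.derivative.eval x * h x).re ∂μ| ≤ B * M := by
      refine abs_integral_le_of_prob (ae_of_all _ fun x => ?_)
      exact hVh x
    rw [energyVariation]
    have h3 : 0 ≤ (L : ℝ) ^ 2 + A * M ^ 2 := by positivity
    rw [abs_le] at *
    constructor <;> linarith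
  · intro t ht
    rw [le_div_iff₀ (by positivity)] at ht
    have hL0 := L.coe_nonneg
    have ht0 := abs_nonneg t
    have htL : |t| * L ≤ 1 / 2 := by nlinarith
    have htM : |t| * M ≤ 1 := by nlinarith
    have ht1 : |t| ≤ 1 := by nlinarith
    have htsq : t ^ 2 ≤ 1 := by rw [← sq_abs]; nlinarith
    obtain ⟨e, he⟩ := exists_variation_homeomorph hL (t := t) (by linarith)
    have hlog : ∀ x y, x ≠ y → |Real.log ‖e x - e y‖ - Real.log ‖x - y‖ -
        t * (diffQuotient h x y).re| ≤ (L : ℝ) ^ 2 * t ^ 2 := by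
      intro x y hxy
      have := abs_log_variation_sub_le hL htL hxy
      rw [mul_pow, sq_abs, mul_comm (t ^ 2)] at this
      rwa [he]
    have hlogb : ∀ x y, x ≠ y → |Real.log ‖e x - e y‖ - Real.log ‖x - y‖| ≤ (L : ℝ) ^ 2 + L := by
      intro x y hxy
      have h1 := hlog x y hxy
      have h2 : |t * (diffQuotient h x y).re| ≤ L := by
        rw [abs_mul]
        have := (Complex.abs_re_le_norm _).trans (norm_diffQuotient_le hL x y)
        nlinarith [abs_nonneg (diffQuotient h x y).re]
      have h3 : (L : ℝ) ^ 2 * t ^ 2 ≤ (L : ℝ) ^ 2 := mul_le_of_le_one_right (by positivity) htsq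
      rw [abs_le] at *
      constructor <;> linarith
    have hφb : ∀ x, |externalField V (e x) - externalField V x| ≤ A * M ^ 2 + B * M := by
      intro x
      have h1 := hφ t htM x
      have h2 : |t * (V.derivative.eval x * h x).re| ≤ B * M := by
        rw [abs_mul]
        have := hVh x
        nlinarith [abs_nonneg (V.derivative.eval x * h x).re]
      have h3 : A * M ^ 2 * t ^ 2 ≤ A * M ^ 2 := mul_le_of_le_one_right (by positivity) htsq
      rw [he]
      rw [abs_le] at *
      constructor <;> linarith
    refine ⟨e, he, fun F μ => ?_⟩
    have hmem : μ.map e ∈ weightedMeasures V (e '' F) ↔ μ ∈ weightedMeasures V F := by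
      have h1 : 0 ≤ (L : ℝ) ^ 2 + L := by positivity
      have h2 : 0 ≤ A * M ^ 2 + B * M := by positivity
      refine map_mem_weightedMeasures_iff e (c := ((L : ℝ) ^ 2 + L) + (A * M ^ 2 + B * M) + M)
        (fun x y hxy => (hlogb x y hxy).trans (by linarith)) (fun x => ?_)
        (fun x => (hφb x).trans (by linarith))
      rw [he, variation, add_sub_cancel_left, norm_mul, Complex.norm_real]
      have h3 : ‖t‖ * ‖h x‖ ≤ 1 * M := mul_le_mul ht1 (hM x) (norm_nonneg _) zero_le_one
      linarith
    refine ⟨hmem, fun hμ => ?_⟩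
    obtain ⟨_, -, -, -, hd, -⟩ := mem_weightedMeasures_iff.1 hμ
    have hem : Measurable e := e.measurable
    have i1 : Integrable (fun p : ℂ × ℂ => Real.log ‖e p.1 - e p.2‖ - Real.log ‖p.1 - p.2‖)
        (μ.prod μ) :=
      Integrable.of_bound (Measurable.aestronglyMeasurable (by fun_prop)) ((L : ℝ) ^ 2 + L)
        (hd.mono fun p hp => hlogb _ _ hp)
    have i2 := integrable_diffQuotient hL μ μ
    have i3 : Integrable (fun x => externalField V (e x) - externalField V x) μ :=
      Integrable.of_bound (((measurable_externalField V).comp hem).sub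
        (measurable_externalField V)).aestronglyMeasurable (A * M ^ 2 + B * M) (ae_of_all _ hφb)
    have i4 : Integrable (fun x => (V.derivative.eval x * h x).re) μ :=
      Integrable.of_bound hVm.aestronglyMeasurable (B * M) (ae_of_all _ hVh)
    have h1 : |∫ p, (Real.log ‖e p.1 - e p.2‖ - Real.log ‖p.1 - p.2‖) ∂(μ.prod μ) -
        t * ∫ p, (diffQuotient h p.1 p.2).re ∂(μ.prod μ)| ≤ (L : ℝ) ^ 2 * t ^ 2 := by
      rw [← integral_const_mul, ← integral_sub i1 (i2.const_mul t)]
      refine abs_integral_le_of_prob ?_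
      exact hd.mono fun p hp => hlog _ _ hp
    have h2 : |∫ x, (externalField V (e x) - externalField V x) ∂μ -
        t * ∫ x, (V.derivative.eval x * h x).re ∂μ| ≤ A * M ^ 2 * t ^ 2 := by
      rw [← integral_const_mul, ← integral_sub i3 (i4.const_mul t)]
      refine abs_integral_le_of_prob ?_
      refine ae_of_all _ fun x => ?_
      rw [he]
      exact hφ t htM x
    rw [weightedEnergy_map_sub e hμ (hmem.2 hμ), energyVariation]
    have h3 : 0 ≤ (L + B * M) * t ^ 2 := by positivity
    rw [abs_le] at *
    constructor <;> nlinarith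

/-! ### Integrals against measures close in the energy norm. -/

/-- Lipschitz test functions cannot distinguish measures that are close in the energy norm. -/
lemma exists_integral_sub_le_of_logEnergySub_le (K : ℝ≥0) {A ε : ℝ} (hA : 0 ≤ A) (hε : 0 < ε) :
    ∃ δ : ℝ, 0 < δ ∧ ∀ (V : Polynomial ℂ) (F : Set ℂ) (μ ν : Measure ℂ),
      μ ∈ weightedMeasures V F → ν ∈ weightedMeasures V F → logEnergySub μ ν ≤ δ →
      ∀ (f : ℂ → ℝ) (M : ℝ), LipschitzWith K f → (∀ x, |f x| ≤ M) →
        Integrable (fun x => f x ^ 2) → ∫ x, f x ^ 2 ≤ A →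
        |∫ x, f x ∂μ - ∫ x, f x ∂ν| ≤ ε := by
  have hK := K.coe_nonneg
  -- Each of the three terms of `abs_integral_sub_integral_le` is to be at most `ε / 3`: `s ≥ q ^ 2`
  -- handles the first, `s ≤ 2 * S` with this `τ` the second, and `8 * δ / (4 * τ) = ε / 3` fixes
  -- `δ`.
  set q : ℝ := 12 * K / ε + 1 with hq
  have hq1 : 1 ≤ q := le_add_of_nonneg_left (by positivity)
  set S : ℝ := q ^ 2 with hS
  have hS0 : 0 < S := by positivity
  set τ : ℝ := ε / (6 * S * (A + 1)) with hτ
  have hτ0 : 0 < τ := by positivity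
  refine ⟨τ * ε / 6, by positivity, fun V F μ ν hμ hν hE f M hf hM hf2 hfA => ?_⟩
  have := hμ.1.1
  have := hν.1.1
  obtain ⟨s, ⟨hs1, hs2⟩, hs⟩ := exists_gaussEnergySub_le hμ hν (by positivity) hS0 hE
  have hs0 : 0 < s := hS0.trans_le hs1
  refine (abs_integral_sub_integral_le (μ := μ) (ν := ν) hf hM hf2 hs0 hτ0).trans ?_
  have h1 : 4 * K / √s ≤ ε / 3 := by
    have h2 : q ≤ √s := Real.le_sqrt_of_sq_le hs1
    rw [div_le_iff₀ (by linarith)]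
    have h3 : 12 * K = (q - 1) * ε := by
      rw [hq]; field_simp; ring
    nlinarith
  have h2 : s * τ * (∫ x, f x ^ 2) ≤ ε / 3 := by
    have h3 : s * τ * (∫ x, f x ^ 2) ≤ 2 * S * τ * (A + 1) := by
      have : s * τ ≤ 2 * S * τ := mul_le_mul_of_nonneg_right hs2 hτ0.le
      exact mul_le_mul this (by linarith) (integral_nonneg fun x => sq_nonneg _) (by positivity)
    have h4 : 2 * S * τ * (A + 1) = ε / 3 := by
      rw [hτ]; field_simp; norm_num
    linarith
  have h3 : gaussEnergySub s μ ν / (4 * τ) ≤ ε / 3 := by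
    rw [div_le_iff₀ (by positivity)]
    linarith
  linarith

/-- One factor is replaced at a time, through `μ × ν`; symmetry of `f` makes the two replacements
alike. -/
lemma abs_integral_prod_sub_le {μ ν : Measure ℂ} [IsProbabilityMeasure μ] [IsProbabilityMeasure ν]
    {f : ℂ → ℂ → ℝ} {M ε : ℝ} (hf : Continuous (Function.uncurry f)) (hsymm : ∀ x y, f x y = f y x)
    (hM : ∀ x y, |f x y| ≤ M) (h : ∀ x, |∫ y, f x y ∂μ - ∫ y, f x y ∂ν| ≤ ε) :
    |∫ p, f p.1 p.2 ∂(μ.prod μ) - ∫ p, f p.1 p.2 ∂(ν.prod ν)| ≤ 2 * ε := by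
  have hi : ∀ (α β : Measure ℂ) [IsProbabilityMeasure α] [IsProbabilityMeasure β],
      Integrable (fun p : ℂ × ℂ => f p.1 p.2) (α.prod β) := fun α β _ _ =>
    Integrable.of_bound hf.aestronglyMeasurable M (ae_of_all _ fun p => hM _ _)
  have hstep : ∀ (α : Measure ℂ) [IsProbabilityMeasure α],
      |∫ p, f p.1 p.2 ∂(α.prod μ) - ∫ p, f p.1 p.2 ∂(α.prod ν)| ≤ ε := by
    intro α _
    rw [integral_prod _ (hi α μ), integral_prod _ (hi α ν),
      ← integral_sub (hi α μ).integral_prod_left (hi α ν).integral_prod_left]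
    exact abs_integral_le_of_prob (ae_of_all _ h)
  have hswap : ∫ p, f p.1 p.2 ∂(μ.prod ν) = ∫ p, f p.1 p.2 ∂(ν.prod μ) := by
    rw [← integral_prod_swap]
    exact integral_congr_ae (ae_of_all _ fun p => hsymm _ _)
  have h1 := hstep μ
  have h2 := hstep ν
  rw [← hswap] at h2
  rw [abs_le] at *
  constructor <;> linarith

/-! ### Truncation of the difference quotient. -/

/-- The kernel `1 / w`, truncated continuously to the annulus `ε ≤ |w| ≤ R`. -/
noncomputable def truncatedInv (ε R : ℝ) (w : ℂ) : ℂ :=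
  conj w * (max 0 (1 / max ‖w‖ ε ^ 2 - 1 / R ^ 2) : ℝ)

section Truncation
variable {ε R : ℝ}

lemma truncatedInv_weight_le (w : ℂ) :
    max 0 (1 / max ‖w‖ ε ^ 2 - 1 / R ^ 2) ≤ 1 / max ‖w‖ ε ^ 2 := by
  refine max_le (by positivity) (sub_le_self _ (by positivity))

lemma norm_truncatedInv_le (hε : 0 < ε) (w : ℂ) : ‖truncatedInv ε R w‖ ≤ 1 / ε := by
  have h1 := truncatedInv_weight_le (ε := ε) (R := R) w
  have hm : ε ≤ max ‖w‖ ε := le_max_right _ _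
  have hm2 : ‖w‖ ≤ max ‖w‖ ε := le_max_left _ _
  have hm0 : 0 < max ‖w‖ ε := hε.trans_le hm
  rw [truncatedInv, norm_mul, RCLike.norm_conj, Complex.norm_real, Real.norm_of_nonneg (le_max_left _ _)]
  calc _ ≤ max ‖w‖ ε * (1 / max ‖w‖ ε ^ 2) :=
        mul_le_mul hm2 h1 (le_max_left _ _) hm0.le
    _ = 1 / max ‖w‖ ε := by field_simp
    _ ≤ 1 / ε := one_div_le_one_div_of_le hε hm

lemma truncatedInv_eq_zero (hR : 0 < R) {w : ℂ} (hw : R ≤ ‖w‖) :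
    truncatedInv ε R w = 0 := by
  have h : max 0 (1 / max ‖w‖ ε ^ 2 - 1 / R ^ 2) = 0 := by
    refine max_eq_left (sub_nonpos.2 (one_div_le_one_div_of_le (by positivity) ?_))
    exact pow_le_pow_left₀ hR.le (hw.trans (le_max_left _ _)) 2
  rw [truncatedInv, h, Complex.ofReal_zero, mul_zero]

lemma abs_one_div_sq_sub_le (hε : 0 < ε) {a b : ℝ} (ha : ε ≤ a) (hb : ε ≤ b) :
    |1 / a ^ 2 - 1 / b ^ 2| ≤ 2 / ε ^ 3 * |a - b| := by
  have ha0 : 0 < a := hε.trans_le ha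
  have hb0 : 0 < b := hε.trans_le hb
  have h1 : 1 / a ^ 2 - 1 / b ^ 2 = -(1 / (a * b ^ 2) + 1 / (a ^ 2 * b)) * (a - b) := by
    field_simp; ring
  have h2 : 1 / (a * b ^ 2) ≤ 1 / ε ^ 3 := by
    refine one_div_le_one_div_of_le (by positivity) ?_
    calc ε ^ 3 = ε * ε ^ 2 := by ring
      _ ≤ a * b ^ 2 := by gcongr
  have h3 : 1 / (a ^ 2 * b) ≤ 1 / ε ^ 3 := by
    refine one_div_le_one_div_of_le (by positivity) ?_
    calc ε ^ 3 = ε ^ 2 * ε := by ring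
      _ ≤ a ^ 2 * b := by gcongr
  rw [h1, abs_mul, abs_neg, abs_of_pos (by positivity)]
  refine mul_le_mul_of_nonneg_right ?_ (abs_nonneg _)
  calc _ ≤ 1 / ε ^ 3 + 1 / ε ^ 3 := add_le_add h2 h3
    _ = 2 / ε ^ 3 := by ring

/-- The product rule leaves a term with factor `‖v‖`, harmless when `‖v‖ ≤ R`. By symmetry one of
the two points may be taken in that disc, unless both lie where the kernel vanishes. -/
lemma norm_truncatedInv_sub_le (hε : 0 < ε) (hR : 0 < R) (w v : ℂ) :
    ‖truncatedInv ε R w - truncatedInv ε R v‖ ≤ (1 / ε ^ 2 + R * (2 / ε ^ 3)) * ‖w - v‖ := by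
  have key : ∀ w v : ℂ, ‖v‖ ≤ R →
      ‖truncatedInv ε R w - truncatedInv ε R v‖ ≤ (1 / ε ^ 2 + R * (2 / ε ^ 3)) * ‖w - v‖ := by
    intro w v hv
    set a : ℝ := max 0 (1 / max ‖w‖ ε ^ 2 - 1 / R ^ 2) with ha
    set b : ℝ := max 0 (1 / max ‖v‖ ε ^ 2 - 1 / R ^ 2) with hb
    have h1 : truncatedInv ε R w - truncatedInv ε R v =
        conj (w - v) * (a : ℂ) + conj v * ((a - b : ℝ) : ℂ) := by
      rw [truncatedInv, truncatedInv, map_sub, Complex.ofReal_sub]; ring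
    have h2 : |a| ≤ 1 / ε ^ 2 := by
      rw [abs_of_nonneg (le_max_left _ _)]
      refine (truncatedInv_weight_le w).trans (one_div_le_one_div_of_le (by positivity) ?_)
      exact pow_le_pow_left₀ hε.le (le_max_right _ _) 2
    have h3 : |a - b| ≤ 2 / ε ^ 3 * ‖w - v‖ := by
      calc |a - b| ≤ |(1 / max ‖w‖ ε ^ 2 - 1 / R ^ 2) - (1 / max ‖v‖ ε ^ 2 - 1 / R ^ 2)| := by
            rw [ha, hb, max_comm 0, max_comm 0]
            exact abs_max_sub_max_le_abs _ _ _
        _ = |1 / max ‖w‖ ε ^ 2 - 1 / max ‖v‖ ε ^ 2| := by congr 1; ring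
        _ ≤ 2 / ε ^ 3 * |max ‖w‖ ε - max ‖v‖ ε| :=
            abs_one_div_sq_sub_le hε (le_max_right _ _) (le_max_right _ _)
        _ ≤ 2 / ε ^ 3 * ‖w - v‖ := by
            refine mul_le_mul_of_nonneg_left ?_ (by positivity)
            exact (abs_max_sub_max_le_abs _ _ _).trans (abs_norm_sub_norm_le _ _)
    rw [h1]
    refine (norm_add_le _ _).trans ?_
    rw [norm_mul, norm_mul, RCLike.norm_conj, RCLike.norm_conj, Complex.norm_real,
      Complex.norm_real, add_mul, Real.norm_eq_abs, Real.norm_eq_abs]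
    refine add_le_add ?_ ?_
    · rw [mul_comm]
      exact mul_le_mul_of_nonneg_right h2 (norm_nonneg _)
    · rw [mul_assoc]
      exact mul_le_mul hv h3 (abs_nonneg _) hR.le
  rcases le_total ‖v‖ R with hv | hv
  · exact key w v hv
  · rcases le_total ‖w‖ R with hw | hw
    · rw [norm_sub_rev, norm_sub_rev w]
      exact key v w hw
    · rw [truncatedInv_eq_zero hR hv, truncatedInv_eq_zero hR hw, sub_zero, norm_zero]
      positivity

/-- The error made by truncating the difference quotient. -/
lemma norm_diffQuotient_sub_truncated_le {h : ℂ → ℂ} {L : ℝ≥0} {M : ℝ} (hL : LipschitzWith L h)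
    (hM : ∀ x, ‖h x‖ ≤ M) (hε : 0 < ε) (hεR : ε ≤ R) (x y : ℂ) :
    ‖diffQuotient h x y - (h x - h y) * truncatedInv ε R (x - y)‖ ≤
      2 * M / R + L * (3 * Real.exp (-(1 / ε ^ 2) * ‖x - y‖ ^ 2)) := by
  have hR : 0 < R := hε.trans_le hεR
  have hM0 : 0 ≤ M := (norm_nonneg _).trans (hM 0)
  have hL0 := L.coe_nonneg
  have hexp := Real.exp_pos (-(1 / ε ^ 2) * ‖x - y‖ ^ 2)
  by_cases hxy : x = y
  · subst hxy
    simp only [diffQuotient, sub_self, zero_mul, zero_div, norm_zero]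
    positivity
  have hw : x - y ≠ 0 := sub_ne_zero.2 hxy
  have hr : 0 < ‖x - y‖ := norm_pos_iff.2 hw
  have h2M : ‖h x - h y‖ ≤ 2 * M := by
    have := norm_sub_le_of_le (hM x) (hM y); linarith
  set q : ℝ := max 0 (1 / max ‖x - y‖ ε ^ 2 - 1 / R ^ 2) with hq
  have hq0 : 0 ≤ q := le_max_left _ _
  have hconj : conj (x - y) * (x - y) = ((‖x - y‖ ^ 2 : ℝ) : ℂ) := by
    rw [Complex.conj_mul', Complex.ofReal_pow]
  -- Since `1 / w = conj w / |w| ^ 2`, the truncation multiplies the quotient by `|w| ^ 2 * q`. The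
  -- relative error `1 - |w| ^ 2 * q` is `|w| ^ 2 / R ^ 2` on the annulus and `1` beyond it.
  have hD : diffQuotient h x y - (h x - h y) * truncatedInv ε R (x - y) =
      diffQuotient h x y * ((1 - ‖x - y‖ ^ 2 * q : ℝ) : ℂ) := by
    have h1 : truncatedInv ε R (x - y) = conj (x - y) * (q : ℂ) := rfl
    rw [h1, Complex.ofReal_sub, Complex.ofReal_mul, ← hconj, diffQuotient]
    field_simp
    push_cast
    ring
  rw [hD, norm_mul, Complex.norm_real, Real.norm_eq_abs]
  have hK : ‖diffQuotient h x y‖ ≤ 2 * M / ‖x - y‖ := by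
    rw [diffQuotient, norm_div]
    exact div_le_div_of_nonneg_right h2M hr.le
  have hfar : ‖diffQuotient h x y‖ * |1 - ‖x - y‖ ^ 2 * q| ≤ 2 * M / R →
      ‖diffQuotient h x y‖ * |1 - ‖x - y‖ ^ 2 * q| ≤
      2 * M / R + L * (3 * Real.exp (-(1 / ε ^ 2) * ‖x - y‖ ^ 2)) := fun h1 => by
    have : 0 ≤ L * (3 * Real.exp (-(1 / ε ^ 2) * ‖x - y‖ ^ 2)) := by positivity
    linarith
  rcases lt_or_ge ‖x - y‖ ε with h1 | h1
  · have h2 : ‖x - y‖ ^ 2 * q ≤ 1 := by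
      have h3 := truncatedInv_weight_le (ε := ε) (R := R) (x - y)
      rw [max_eq_right h1.le] at h3
      rw [hq, max_eq_right h1.le]
      calc _ ≤ ε ^ 2 * (1 / ε ^ 2) :=
            mul_le_mul (pow_le_pow_left₀ hr.le h1.le 2) h3 (le_max_left _ _) (by positivity)
        _ = 1 := by field_simp
    have h4 : |1 - ‖x - y‖ ^ 2 * q| ≤ 1 := by
      have : 0 ≤ ‖x - y‖ ^ 2 * q := by positivity
      rw [abs_le]; constructor <;> linarith
    -- For `‖x - y‖ < ε` the Gaussian is at least `1 / e`, and `e < 3`.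
    have h5 : 1 ≤ 3 * Real.exp (-(1 / ε ^ 2) * ‖x - y‖ ^ 2) := by
      have h6 : -1 ≤ -(1 / ε ^ 2) * ‖x - y‖ ^ 2 := by
        rw [neg_mul, neg_le_neg_iff, one_div, inv_mul_le_iff₀ (by positivity), mul_one]
        exact pow_le_pow_left₀ hr.le h1.le 2
      have h7 := Real.exp_le_exp.2 h6
      have h8 : Real.exp 1 * Real.exp (-1) = 1 := by rw [← Real.exp_add]; simp
      have h9 := Real.exp_one_lt_d9
      nlinarith [Real.exp_pos (-1)]
    have h6 : ‖diffQuotient h x y‖ * |1 - ‖x - y‖ ^ 2 * q| ≤ L * 1 :=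
      mul_le_mul (norm_diffQuotient_le hL x y) h4 (abs_nonneg _) hL0
    have h7 : (L : ℝ) * 1 ≤ L * (3 * Real.exp (-(1 / ε ^ 2) * ‖x - y‖ ^ 2)) :=
      mul_le_mul_of_nonneg_left h5 hL0
    have h8 : 0 ≤ 2 * M / R := by positivity
    linarith
  · apply hfar
    rcases le_total ‖x - y‖ R with h2 | h2
    · have h3 : q = 1 / ‖x - y‖ ^ 2 - 1 / R ^ 2 := by
        rw [hq, max_eq_left h1]
        refine max_eq_right (sub_nonneg.2 (one_div_le_one_div_of_le (by positivity) ?_))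
        exact pow_le_pow_left₀ hr.le h2 2
      have h4 : 1 - ‖x - y‖ ^ 2 * q = ‖x - y‖ ^ 2 / R ^ 2 := by
        rw [h3]; field_simp; ring
      rw [h4, abs_of_nonneg (by positivity)]
      calc _ ≤ 2 * M / ‖x - y‖ * (‖x - y‖ ^ 2 / R ^ 2) :=
            mul_le_mul_of_nonneg_right hK (by positivity)
        _ = 2 * M / R * (‖x - y‖ / R) := by field_simp
        _ ≤ 2 * M / R * 1 := by
            refine mul_le_mul_of_nonneg_left ?_ (by positivity)
            rwa [div_le_one hR]
        _ = 2 * M / R := mul_one _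
    · have h3 : q = 0 := by
        refine max_eq_left (sub_nonpos.2 (one_div_le_one_div_of_le (by positivity) ?_))
        exact pow_le_pow_left₀ hR.le (h2.trans (le_max_left _ _)) 2
      rw [h3, mul_zero, sub_zero, abs_one, mul_one]
      refine hK.trans (div_le_div_of_nonneg_left (by positivity) hR h2)

end Truncation

/-- The bound does not depend on the centre `c`. This gives one `L²` bound for all slices of the
truncated quotient, just as `lipschitzWith_truncatedQuotient` gives one Lipschitz constant. -/
lemma integral_sq_le_of_bounded_support {f : ℂ → ℝ} (hf : Continuous f) {M R : ℝ} {c : ℂ}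
    (hM : ∀ x, |f x| ≤ M) (hR : ∀ x, R < ‖x - c‖ → f x = 0) :
    Integrable (fun x => f x ^ 2) ∧
      ∫ x, f x ^ 2 ≤ M ^ 2 * volume.real (Metric.closedBall (0 : ℂ) R) := by
  have hvol : volume (Metric.closedBall c R) = volume (Metric.closedBall (0 : ℂ) R) :=
    Measure.addHaar_closedBall_center _ _ _
  have hfin : volume (Metric.closedBall c R) ≠ ⊤ := (isCompact_closedBall c R).measure_ne_top
  have hi : Integrable (fun x => (Metric.closedBall c R).indicator (fun _ => M ^ 2) x) :=
    (integrable_indicator_iff measurableSet_closedBall).2 (integrableOn_const hfin)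
  have hle : ∀ x, f x ^ 2 ≤ (Metric.closedBall c R).indicator (fun _ => M ^ 2) x := by
    intro x
    by_cases hx : x ∈ Metric.closedBall c R
    · rw [Set.indicator_of_mem hx, ← sq_abs]
      exact pow_le_pow_left₀ (abs_nonneg _) (hM x) 2
    · rw [Set.indicator_of_notMem hx]
      rw [Metric.mem_closedBall, dist_eq_norm, not_le] at hx
      rw [hR x hx]
      norm_num
  have hi2 : Integrable (fun x => f x ^ 2) :=
    hi.mono' (by fun_prop) (ae_of_all _ fun x => by
      rw [Real.norm_of_nonneg (sq_nonneg _)]; exact hle x)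
  refine ⟨hi2, (integral_mono hi2 hi hle).trans_eq ?_⟩
  rw [integral_indicator measurableSet_closedBall, setIntegral_const, measureReal_def, hvol,
    smul_eq_mul, mul_comm, measureReal_def]

/-- The real part of the truncated difference quotient. -/
noncomputable def truncatedQuotient (h : ℂ → ℂ) (ε R : ℝ) (x y : ℂ) : ℝ :=
  ((h x - h y) * truncatedInv ε R (x - y)).re

section TruncatedQuotient
variable {h : ℂ → ℂ} {L : ℝ≥0} {M ε R : ℝ}

lemma truncatedQuotient_symm (x y : ℂ) :
    truncatedQuotient h ε R x y = truncatedQuotient h ε R y x := by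
  have h1 : truncatedInv ε R (x - y) = -truncatedInv ε R (y - x) := by
    rw [truncatedInv, truncatedInv, norm_sub_rev, ← neg_sub y x, map_neg, neg_mul]
  rw [truncatedQuotient, truncatedQuotient, h1]
  congr 1
  ring

lemma abs_truncatedQuotient_le (hM : ∀ x, ‖h x‖ ≤ M) (hε : 0 < ε) (x y : ℂ) :
    |truncatedQuotient h ε R x y| ≤ 2 * M / ε := by
  refine (Complex.abs_re_le_norm _).trans ?_
  rw [norm_mul]
  have h1 : ‖h x - h y‖ ≤ 2 * M := by
    have := norm_sub_le_of_le (hM x) (hM y); linarith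
  calc _ ≤ 2 * M * (1 / ε) := mul_le_mul h1 (norm_truncatedInv_le hε _) (norm_nonneg _)
        ((norm_nonneg _).trans h1)
    _ = 2 * M / ε := by ring

lemma lipschitzWith_truncatedQuotient (hL : LipschitzWith L h) (hM : ∀ x, ‖h x‖ ≤ M) (hε : 0 < ε)
    (hR : 0 < R) (x : ℂ) :
    LipschitzWith (L * (1 / ε) + 2 * M * (1 / ε ^ 2 + R * (2 / ε ^ 3))).toNNReal
      (truncatedQuotient h ε R x) := by
  have hM0 : 0 ≤ M := (norm_nonneg _).trans (hM 0)
  refine LipschitzWith.of_dist_le_mul fun y z => ?_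
  rw [Real.coe_toNNReal _ (by positivity), Real.dist_eq, dist_eq_norm, truncatedQuotient,
    truncatedQuotient, ← Complex.sub_re]
  refine (Complex.abs_re_le_norm _).trans ?_
  have h1 : (h x - h y) * truncatedInv ε R (x - y) - (h x - h z) * truncatedInv ε R (x - z) =
      (h z - h y) * truncatedInv ε R (x - y) +
        (h x - h z) * (truncatedInv ε R (x - y) - truncatedInv ε R (x - z)) := by ring
  have h2 : ‖h z - h y‖ ≤ L * ‖y - z‖ := by
    have := hL.dist_le_mul z y
    rwa [dist_eq_norm, dist_eq_norm, norm_sub_rev z y] at this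
  have h3 : ‖h x - h z‖ ≤ 2 * M := by
    have := norm_sub_le_of_le (hM x) (hM z); linarith
  have h4 := norm_truncatedInv_sub_le hε hR (x - y) (x - z)
  rw [sub_sub_sub_cancel_left, norm_sub_rev z y] at h4
  rw [h1]
  refine (norm_add_le _ _).trans ?_
  rw [norm_mul, norm_mul, add_mul]
  refine add_le_add ?_ ?_
  · calc _ ≤ L * ‖y - z‖ * (1 / ε) := mul_le_mul h2 (norm_truncatedInv_le hε _) (norm_nonneg _)
          (by positivity)
      _ = L * (1 / ε) * ‖y - z‖ := by ring
  · rw [mul_assoc]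
    exact mul_le_mul h3 h4 (norm_nonneg _) (by positivity)

lemma truncatedQuotient_eq_zero (hR : 0 < R) {x y : ℂ} (hxy : R < ‖y - x‖) :
    truncatedQuotient h ε R x y = 0 := by
  rw [truncatedQuotient, truncatedInv_eq_zero hR (by rw [norm_sub_rev]; exact hxy.le), mul_zero,
    Complex.zero_re]

lemma continuous_truncatedQuotient (hh : Continuous h) (hε : 0 < ε) :
    Continuous (Function.uncurry (truncatedQuotient h ε R)) := by
  have hm : ∀ p : ℂ × ℂ, max ‖p.1 - p.2‖ ε ^ 2 ≠ 0 := fun p =>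
    pow_ne_zero 2 (hε.trans_le (le_max_right _ _)).ne'
  have h1 : Continuous (fun p : ℂ × ℂ =>
      max 0 (1 / max ‖p.1 - p.2‖ ε ^ 2 - 1 / R ^ 2)) :=
    continuous_const.max ((continuous_const.div (by fun_prop) hm).sub continuous_const)
  have h2 : Continuous (fun p : ℂ × ℂ => conj (p.1 - p.2)) :=
    Complex.continuous_conj.comp (by fun_prop)
  have h3 : Continuous (fun p : ℂ × ℂ => h p.1 - h p.2) := by fun_prop
  exact Complex.continuous_re.comp (h3.mul (h2.mul (Complex.continuous_ofReal.comp h1)))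

lemma abs_integral_diffQuotient_sub_truncated_le {μ : Measure ℂ} [IsProbabilityMeasure μ]
    (hL : LipschitzWith L h) (hM : ∀ x, ‖h x‖ ≤ M) (hε : 0 < ε) (hεR : ε ≤ R) :
    |∫ p, (diffQuotient h p.1 p.2).re ∂(μ.prod μ) -
      ∫ p, truncatedQuotient h ε R p.1 p.2 ∂(μ.prod μ)| ≤
      2 * M / R + L * (3 * gaussEnergy (1 / ε ^ 2) μ μ) := by
  have i1 := integrable_diffQuotient hL μ μ
  have i2 : Integrable (fun p : ℂ × ℂ => truncatedQuotient h ε R p.1 p.2) (μ.prod μ) :=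
    Integrable.of_bound (continuous_truncatedQuotient hL.continuous hε).aestronglyMeasurable
      (2 * M / ε) (ae_of_all _ fun p => abs_truncatedQuotient_le hM hε _ _)
  have i3 := (((integrable_gauss_kernel (μ := μ) (ν := μ) (s := 1 / ε ^ 2)
    (by positivity)).const_mul 3).const_mul (L : ℝ))
  rw [← integral_sub i1 i2]
  have h1 := norm_integral_le_of_norm_le (f := fun p : ℂ × ℂ => (diffQuotient h p.1 p.2).re -
    truncatedQuotient h ε R p.1 p.2) ((integrable_const (2 * M / R)).add i3)
    (ae_of_all (μ.prod μ) fun p => by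
      rw [truncatedQuotient, ← Complex.sub_re]
      exact (Complex.abs_re_le_norm _).trans (norm_diffQuotient_sub_truncated_le hL hM hε hεR _ _))
  refine h1.trans_eq ?_
  simp only [Pi.add_apply]
  rw [integral_add (integrable_const _) i3, integral_const, probReal_univ, one_smul,
    integral_const_mul, integral_const_mul, gaussEnergy]

end TruncatedQuotient

/-! ### Near-constancy of the first variation on near-minimizers. -/

lemma exists_re_bounds {g : ℂ → ℂ} (hg : ContDiff ℝ 2 g) (hc : HasCompactSupport g) :
    ∃ (K : ℝ≥0) (B : ℝ), LipschitzWith K (fun x => (g x).re) ∧ (∀ x, |(g x).re| ≤ B) ∧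
      Integrable (fun x => (g x).re ^ 2) := by
  obtain ⟨K, hK⟩ := ContDiff.lipschitzWith_of_hasCompactSupport hc hg (by norm_num)
  obtain ⟨B, hB⟩ := hc.exists_bound_of_continuous hg.continuous
  have h1 : HasCompactSupport (fun x => (g x).re ^ 2) :=
    hc.comp_left (g := fun z : ℂ => z.re ^ 2) (by simp)
  refine ⟨K, B, ?_, fun x => (Complex.abs_re_le_norm _).trans (hB x), ?_⟩
  · refine LipschitzWith.of_dist_le_mul fun x y => ?_
    have h2 := hK.dist_le_mul x y
    rw [dist_eq_norm] at h2
    rw [Real.dist_eq, ← Complex.sub_re]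
    exact (Complex.abs_re_le_norm _).trans h2
  · exact ((Complex.continuous_re.comp hg.continuous).pow 2).integrable_of_hasCompactSupport h1

lemma IsTestFunction.exists_linear_bounds (V : Polynomial ℂ) {h : ℂ → ℂ} (hh : IsTestFunction h) :
    ∃ (K : ℝ≥0) (B : ℝ), LipschitzWith K (fun x => (V.derivative.eval x * h x).re) ∧
      (∀ x, |(V.derivative.eval x * h x).re| ≤ B) ∧
      Integrable (fun x => (V.derivative.eval x * h x).re ^ 2) := by
  have h0 : ContDiff ℂ 2 (fun x : ℂ => V.derivative.eval x) := by
    simpa only [Polynomial.coe_aeval_eq_eval] using V.derivative.contDiff_aeval (𝕜 := ℂ) 2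
  have h1 : ContDiff ℝ 2 (fun x : ℂ => V.derivative.eval x) := h0.restrict_scalars ℝ
  exact exists_re_bounds (h1.mul hh.1) hh.2.mul_left

/-- The first variation takes nearly the same value on all measures of nearly minimal energy. -/
lemma exists_energyVariation_sub_le (V : Polynomial ℂ) {F : Set ℂ} {I : ℝ}
    (hI : weightedSetEnergy V F = (I : EReal)) {h : ℂ → ℂ} (hh : IsTestFunction h) {ε : ℝ}
    (hε : 0 < ε) :
    ∃ η : ℝ, 0 < η ∧ ∀ μ ν : Measure ℂ, μ ∈ weightedMeasures V F → ν ∈ weightedMeasures V F →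
      weightedEnergy V μ ≤ I + η → weightedEnergy V ν ≤ I + η →
      |energyVariation V h μ - energyVariation V h ν| ≤ ε := by
  obtain ⟨L, M, -, hM0, hL, hM, -⟩ := hh.exists_bounds
  obtain ⟨K₁, B₁, hK₁, hB₁, hB₁'⟩ := hh.exists_linear_bounds V
  have hL0 := L.coe_nonneg
  -- The factor `66 = 2 + 2 * 8 * 4` combines `gaussEnergy_le`, `exists_gaussEnergySub_le` and
  -- `logEnergySub_le_of_near_minimizer`.
  set κ : ℝ := ε / (2000 * (L + 1)) with hκ
  have hκ0 : 0 < κ := by positivity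
  have hκL : L * (3 * (66 * κ)) ≤ ε / 10 := by
    have : κ * (2000 * (L + 1)) = ε := by rw [hκ]; field_simp
    nlinarith
  obtain ⟨ρ, hρ, hρI⟩ : ∃ ρ ∈ weightedMeasures V F, weightedEnergy V ρ ≤ I + κ := by
    by_contra! hc
    have h1 : ((I + κ : ℝ) : EReal) ≤ weightedSetEnergy V F :=
      le_iInf₂ fun μ hμ => EReal.coe_le_coe_iff.2 (hc μ hμ).le
    rw [hI, EReal.coe_le_coe_iff] at h1
    linarith
  have := hρ.1.1
  obtain ⟨B, hB1, hBρ⟩ : ∃ B : ℝ, 1 ≤ B ∧ gaussEnergy B ρ ρ ≤ κ := by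
    have h1 := tendsto_gaussEnergy_atTop (integrable_log_dist_of_mem hρ hρ).2
    exact ((eventually_ge_atTop 1).and (h1.eventually (eventually_le_nhds hκ0))).exists
  -- With `1 / r ^ 2 = 2 * B`, the Gaussian in the diagonal error sits at the end of the window `[B,
  -- 2B]`. Monotonicity in `s` then compares it with the uncontrolled scale found inside that
  -- window.
  set r : ℝ := 1 / √(2 * B) with hr
  have hsq : 1 ≤ √(2 * B) := Real.one_le_sqrt.2 (by linarith)
  have hr0 : 0 < r := by positivity
  have hr1 : r ≤ 1 := (div_le_one (by positivity)).2 hsq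
  have hr2 : 1 / r ^ 2 = 2 * B := by
    rw [hr, div_pow, Real.sq_sqrt (by linarith)]; field_simp
  set R : ℝ := 20 * M / ε + 1 with hR
  have hR1 : 1 ≤ R := le_add_of_nonneg_left (by positivity)
  have hR0 : 0 < R := by linarith
  have hRM : 2 * M / R ≤ ε / 10 := by
    rw [div_le_iff₀ hR0, hR]
    have : ε / 10 * (20 * M / ε + 1) = 2 * M + ε / 10 := by field_simp; ring
    linarith
  have hnear : ∀ μ ∈ weightedMeasures V F, weightedEnergy V μ ≤ I + κ →
      |∫ p, (diffQuotient h p.1 p.2).re ∂(μ.prod μ) -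
        ∫ p, truncatedQuotient h r R p.1 p.2 ∂(μ.prod μ)| ≤ ε / 5 := by
    intro μ hμ hμI
    have := hμ.1.1
    have h1 := logEnergySub_le_of_near_minimizer hI hμ hρ hμI hρI
    obtain ⟨s, hs, hs'⟩ := exists_gaussEnergySub_le hμ hρ (by positivity)
      (by linarith : 0 < B) h1
    have hs0 : 0 < s := by linarith [hs.1]
    have h2 : gaussEnergy (2 * B) μ μ ≤ gaussEnergy s μ μ := gaussEnergy_anti hs0.le hs.2
    have h3 := gaussEnergy_le (μ := μ) (ν := ρ) hs0
    have h4 : gaussEnergy s ρ ρ ≤ gaussEnergy B ρ ρ := gaussEnergy_anti (by linarith) hs.1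
    have h5 : gaussEnergy (2 * B) μ μ ≤ 66 * κ := by linarith
    refine (abs_integral_diffQuotient_sub_truncated_le hL hM hr0 (hr1.trans hR1)).trans ?_
    rw [hr2]
    have h6 : L * (3 * gaussEnergy (2 * B) μ μ) ≤ L * (3 * (66 * κ)) :=
      mul_le_mul_of_nonneg_left (by linarith) hL0
    linarith
  obtain ⟨δ₁, hδ₁, H₁⟩ := exists_integral_sub_le_of_logEnergySub_le
    (L * (1 / r) + 2 * M * (1 / r ^ 2 + R * (2 / r ^ 3))).toNNReal
    (A := (2 * M / r) ^ 2 * volume.real (Metric.closedBall (0 : ℂ) R)) (ε := ε / 10)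
    (by positivity) (by positivity)
  obtain ⟨δ₂, hδ₂, H₂⟩ := exists_integral_sub_le_of_logEnergySub_le K₁
    (A := ∫ x, (V.derivative.eval x * h x).re ^ 2) (ε := ε / 10)
    (integral_nonneg fun x => sq_nonneg _) (by positivity)
  refine ⟨min κ (min (δ₁ / 4) (δ₂ / 4)), by positivity, fun μ ν hμ hν hμI hνI => ?_⟩
  have := hμ.1.1
  have := hν.1.1
  have hE := logEnergySub_le_of_near_minimizer hI hμ hν hμI hνI
  have hm1 : min κ (min (δ₁ / 4) (δ₂ / 4)) ≤ κ := min_le_left _ _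
  have hm2 : min κ (min (δ₁ / 4) (δ₂ / 4)) ≤ δ₁ / 4 := (min_le_right _ _).trans (min_le_left _ _)
  have hm3 : min κ (min (δ₁ / 4) (δ₂ / 4)) ≤ δ₂ / 4 := (min_le_right _ _).trans (min_le_right _ _)
  have e1 := hnear μ hμ (by linarith)
  have e2 := hnear ν hν (by linarith)
  have e3 := abs_integral_prod_sub_le (μ := μ) (ν := ν) (f := truncatedQuotient h r R)
    (M := 2 * M / r) (ε := ε / 10)
    (continuous_truncatedQuotient hL.continuous hr0) truncatedQuotient_symm
    (abs_truncatedQuotient_le hM hr0) (fun x => by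
      have hlip := lipschitzWith_truncatedQuotient hL hM hr0 hR0 x
      obtain ⟨a, b⟩ := integral_sq_le_of_bounded_support hlip.continuous
        (abs_truncatedQuotient_le hM hr0 x) (c := x) (R := R)
        (fun y hy => truncatedQuotient_eq_zero hR0 hy)
      exact H₁ V F μ ν hμ hν (by linarith) _ _ hlip (abs_truncatedQuotient_le hM hr0 x) a b)
  have e4 := H₂ V F μ ν hμ hν (by linarith) _ B₁ hK₁ hB₁ hB₁' le_rfl
  rw [energyVariation, energyVariation]
  rw [abs_le] at *
  constructor <;> linarith

/-! ### Differentiation of the energy of the set. -/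

/-- The weighted energy of the deformed set as an infimum over measures on the original set. -/
lemma weightedSetEnergy_image {V : Polynomial ℂ} {F : Set ℂ} (e : ℂ ≃ₜ ℂ)
    (he : ∀ μ : Measure ℂ, μ.map e ∈ weightedMeasures V (e '' F) ↔ μ ∈ weightedMeasures V F) :
    weightedSetEnergy V (e '' F) =
      ⨅ μ ∈ weightedMeasures V F, ((weightedEnergy V (μ.map e) : ℝ) : EReal) := by
  apply le_antisymm
  · exact le_iInf₂ fun μ hμ => iInf₂_le _ ((he μ).2 hμ)
  · refine le_iInf₂ fun ν hν => ?_
    have hmap : (ν.map e.symm).map e = ν := by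
      rw [Measure.map_map e.measurable e.symm.measurable]
      simp
    rw [← hmap] at hν ⊢
    exact iInf₂_le _ ((he _).1 hν)

lemma mem_weightedMeasures_univ {V : Polynomial ℂ} {F : Set ℂ} {μ : Measure ℂ}
    (hμ : μ ∈ weightedMeasures V F) : μ ∈ weightedMeasures V Set.univ :=
  ⟨⟨hμ.1.1, by simp, hμ.1.2.2⟩, hμ.2⟩

lemma exists_lt_of_weightedSetEnergy {V : Polynomial ℂ} {F : Set ℂ} {I η : ℝ}
    (hI : weightedSetEnergy V F = (I : EReal)) (hη : 0 < η) :
    ∃ μ ∈ weightedMeasures V F, weightedEnergy V μ < I + η := by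
  by_contra! hc
  have h1 : ((I + η : ℝ) : EReal) ≤ weightedSetEnergy V F :=
    le_iInf₂ fun μ hμ => EReal.coe_le_coe_iff.2 (hc μ hμ)
  rw [hI, EReal.coe_le_coe_iff] at h1
  linarith

/-- The first variation converges along minimizing measures. -/
lemma exists_energyVariation_limit (V : Polynomial ℂ) {F : Set ℂ} {I : ℝ}
    (hI : weightedSetEnergy V F = (I : EReal)) {h : ℂ → ℂ} (hh : IsTestFunction h) :
    ∃ D : ℝ, ∀ ε : ℝ, 0 < ε → ∃ η : ℝ, 0 < η ∧ ∀ μ ∈ weightedMeasures V F,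
      weightedEnergy V μ ≤ I + η → |energyVariation V h μ - D| ≤ ε := by
  have hex : ∀ n : ℕ, ∃ μ ∈ weightedMeasures V F, weightedEnergy V μ < I + 1 / ((n : ℝ) + 1) :=
    fun n => exists_lt_of_weightedSetEnergy hI Nat.one_div_pos_of_nat
  choose m hm hmI using hex
  have hlim : Tendsto (fun n : ℕ => 1 / ((n : ℝ) + 1)) atTop (𝓝 0) :=
    tendsto_one_div_add_atTop_nhds_zero_nat
  have hsmall : ∀ η : ℝ, 0 < η → ∃ N : ℕ, ∀ n ≥ N, weightedEnergy V (m n) ≤ I + η := by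
    intro η hη
    obtain ⟨N, hN⟩ := eventually_atTop.1 (hlim.eventually (eventually_le_nhds hη))
    exact ⟨N, fun n hn => by linarith [hmI n, hN n hn]⟩
  have hcauchy : CauchySeq (fun n => energyVariation V h (m n)) := by
    refine Metric.cauchySeq_iff'.2 fun ε hε => ?_
    obtain ⟨η, hη, H⟩ := exists_energyVariation_sub_le V hI hh (half_pos hε)
    obtain ⟨N, hN⟩ := hsmall η hη
    refine ⟨N, fun n hn => ?_⟩
    rw [Real.dist_eq]
    exact (H _ _ (hm n) (hm N) (hN n hn) (hN N le_rfl)).trans_lt (half_lt_self hε)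
  obtain ⟨D, hD⟩ := cauchySeq_tendsto_of_complete hcauchy
  refine ⟨D, fun ε hε => ?_⟩
  obtain ⟨η, hη, H⟩ := exists_energyVariation_sub_le V hI hh hε
  refine ⟨η, hη, fun μ hμ hμI => ?_⟩
  obtain ⟨N, hN⟩ := hsmall η hη
  refine le_of_tendsto ((tendsto_const_nhds.sub hD).abs) ?_
  filter_upwards [eventually_ge_atTop N] with n hn
  exact H μ (m n) hμ (hm n) hμI (hN n hn)

lemma abs_div_sub_le {a t D c : ℝ} (ht : t ≠ 0) (h : |a - t * D| ≤ c * |t|) : |a / t - D| ≤ c := by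
  have h1 : a / t - D = (a - t * D) / t := by field_simp
  rw [h1, abs_div, div_le_iff₀ (abs_pos.2 ht)]
  exact h

/-- `D` is the limit of the first variation along minimizing sequences, so no equilibrium measure
need exist. A near-minimizer for `F` bounds the energy of `F^t` from above; a near-minimizer for
`F^t`, pulled back, is again one for `F` and bounds it from below. -/
lemma exists_hasEnergyDeriv (V : Polynomial ℂ) {F : Set ℂ} (hbot : weightedSetEnergy V F ≠ ⊥)
    (htop : weightedSetEnergy V F ≠ ⊤) {h : ℂ → ℂ} (hh : IsTestFunction h) :
    ∃ D : ℝ, HasSetEnergyDeriv V h F D ∧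
      ∀ μ : Measure ℂ, IsEquilibriumMeasure V F μ → HasMeasureEnergyDeriv V h μ D := by
  set I : ℝ := (weightedSetEnergy V F).toReal with hIdef
  have hI : weightedSetEnergy V F = (I : EReal) := (EReal.coe_toReal htop hbot).symm
  obtain ⟨C, t₀, hC, ht₀, hDC, H⟩ := exists_weightedEnergy_expansion V hh
  obtain ⟨D, hD⟩ := exists_energyVariation_limit V hI hh
  have hsmall : ∀ r : ℝ, 0 < r → ∀ᶠ t : ℝ in 𝓝 0, |t| ≤ r := fun r hr => by
    have : Tendsto (fun t : ℝ => |t|) (𝓝 0) (𝓝 0) := by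
      simpa using (continuous_abs.tendsto (0 : ℝ))
    exact this.eventually (eventually_le_nhds hr)
  -- two-sided bound for the energy of the deformed set
  have hset : ∀ t : ℝ, |t| ≤ t₀ → ∃ J : ℝ, weightedSetEnergy V (variation h t '' F) = (J : EReal) ∧
      (∀ μ ∈ weightedMeasures V F,
        J ≤ weightedEnergy V μ + t * energyVariation V h μ + C * t ^ 2) ∧
      (∀ η : ℝ, 0 < η → ∃ μ ∈ weightedMeasures V F,
        weightedEnergy V μ + t * energyVariation V h μ - C * t ^ 2 < J + η) := by
    intro t ht
    obtain ⟨e, he, He⟩ := H t ht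
    have hmap := weightedSetEnergy_image e (fun μ => (He F μ).1)
    have hbound : ∀ μ ∈ weightedMeasures V F, |weightedEnergy V (μ.map e) - weightedEnergy V μ -
        t * energyVariation V h μ| ≤ C * t ^ 2 := fun μ hμ => (He F μ).2 hμ
    have hIle : ∀ μ ∈ weightedMeasures V F, I ≤ weightedEnergy V μ := fun μ hμ => by
      rw [← EReal.coe_le_coe_iff, ← hI]
      exact iInf₂_le _ hμ
    -- A crude bound, enough for finiteness of the deformed energy.
    have hlow : ((I - |t| * C - C * t ^ 2 : ℝ) : EReal) ≤ weightedSetEnergy V (e '' F) := by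
      rw [hmap]
      refine le_iInf₂ fun μ hμ => EReal.coe_le_coe_iff.2 ?_
      have h1 := abs_le.1 (hbound μ hμ)
      have h2 : |t * energyVariation V h μ| ≤ |t| * C := by
        rw [abs_mul]
        exact mul_le_mul_of_nonneg_left (hDC μ hμ.1.1) (abs_nonneg t)
      have h3 := abs_le.1 h2
      have h4 := hIle μ hμ
      linarith [h1.1, h3.1]
    obtain ⟨ρ, hρ, -⟩ := exists_lt_of_weightedSetEnergy hI one_pos
    have hup : weightedSetEnergy V (e '' F) ≤ ((weightedEnergy V (ρ.map e) : ℝ) : EReal) :=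
      iInf₂_le _ ((He F ρ).1.2 hρ)
    have hb : weightedSetEnergy V (e '' F) ≠ ⊥ := fun hc => by
      rw [hc, le_bot_iff] at hlow
      exact EReal.coe_ne_bot _ hlow
    have ht' : weightedSetEnergy V (e '' F) ≠ ⊤ := fun hc => by
      rw [hc, top_le_iff] at hup
      exact EReal.coe_ne_top _ hup
    have hJ := (EReal.coe_toReal ht' hb).symm
    refine ⟨(weightedSetEnergy V (e '' F)).toReal, by rw [← he]; exact hJ, ?_, ?_⟩
    · intro μ hμ
      have h1 : weightedSetEnergy V (e '' F) ≤ ((weightedEnergy V (μ.map e) : ℝ) : EReal) :=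
        iInf₂_le _ ((He F μ).1.2 hμ)
      rw [hJ, EReal.coe_le_coe_iff] at h1
      linarith [(abs_le.1 (hbound μ hμ)).2]
    · intro η hη
      by_contra! hc
      have h1 : (((weightedSetEnergy V (e '' F)).toReal + η : ℝ) : EReal) ≤
          weightedSetEnergy V (e '' F) := by
        conv_rhs => rw [hmap]
        refine le_iInf₂ fun μ hμ => EReal.coe_le_coe_iff.2 ?_
        linarith [(abs_le.1 (hbound μ hμ)).1, hc μ hμ]
      rw [hJ, EReal.toReal_coe, EReal.coe_le_coe_iff] at h1
      linarith
  refine ⟨D, ⟨⟨hbot, htop⟩, ?_, ?_⟩, ?_⟩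
  · filter_upwards [hsmall t₀ ht₀] with t ht
    obtain ⟨J, hJ, -⟩ := hset t ht
    rw [hJ]
    exact ⟨EReal.coe_ne_bot _, EReal.coe_ne_top _⟩
  · rw [← hIdef]
    refine Metric.tendsto_nhds.2 fun ε hε => ?_
    obtain ⟨η, hη, hηD⟩ := hD (ε / 4) (by positivity)
    filter_upwards [self_mem_nhdsWithin, nhdsWithin_le_nhds (hsmall t₀ ht₀),
      nhdsWithin_le_nhds (hsmall 1 one_pos),
      nhdsWithin_le_nhds (hsmall (η / (4 * (C + 1))) (by positivity)),
      nhdsWithin_le_nhds (hsmall (ε / (4 * (C + 1))) (by positivity))] with t ht0 ht1 ht2 ht3 ht4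
    have ht0 : t ≠ 0 := ht0
    have htp : 0 < |t| := abs_pos.2 ht0
    obtain ⟨J, hJ, hJup, hJlow⟩ := hset t ht1
    rw [hJ, EReal.toReal_coe, Real.dist_eq]
    rw [le_div_iff₀ (by positivity)] at ht3 ht4
    have hsq : t ^ 2 = |t| * |t| := by rw [← sq_abs, sq]
    have hsq0 : 0 < t ^ 2 := by positivity
    have htsq : t ^ 2 ≤ |t| := by rw [hsq]; nlinarith
    have hCt : C * t ^ 2 ≤ C * |t| := mul_le_mul_of_nonneg_left htsq hC
    have hεt : (C + 1) * t ^ 2 ≤ ε / 4 * |t| := by rw [hsq]; nlinarith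
    have hkey : ∀ μ ∈ weightedMeasures V F, |energyVariation V h μ - D| ≤ ε / 4 →
        |t * energyVariation V h μ - t * D| ≤ ε / 4 * |t| := fun μ hμ hm => by
      rw [← mul_sub, abs_mul, mul_comm]
      exact mul_le_mul_of_nonneg_right hm htp.le
    have hup : J - I - t * D ≤ ε / 2 * |t| := by
      -- Minimizing up to `t ^ 2` suffices, as this error disappears after division by `t`.
      obtain ⟨μ, hμ, hμI⟩ := exists_lt_of_weightedSetEnergy hI hsq0
      have h1 := hJup μ hμ
      have h2 := hηD μ hμ (by nlinarith)
      have h3 := (abs_le.1 (hkey μ hμ h2)).2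
      nlinarith
    have hlow : -(ε / 2 * |t|) ≤ J - I - t * D := by
      obtain ⟨μ, hμ, hμJ⟩ := hJlow (t ^ 2) hsq0
      have hIμ : I ≤ weightedEnergy V μ := by
        rw [← EReal.coe_le_coe_iff, ← hI]
        exact iInf₂_le _ hμ
      -- It follows that the `μ` nearly optimal for `F^t` has energy at most `I + 4 * (C + 1) * |t|
      -- ≤ I + η`, so its first variation is close to `D`.
      have hJI : J ≤ I + C * |t| + (C + 1) * t ^ 2 := by
        obtain ⟨ν, hν, hνI⟩ := exists_lt_of_weightedSetEnergy hI hsq0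
        have h1 := hJup ν hν
        have h2 : |t * energyVariation V h ν| ≤ |t| * C := by
          rw [abs_mul]
          exact mul_le_mul_of_nonneg_left (hDC ν hν.1.1) (abs_nonneg t)
        have h3 := (abs_le.1 h2).2
        nlinarith
      have h2 : |t * energyVariation V h μ| ≤ |t| * C := by
        rw [abs_mul]
        exact mul_le_mul_of_nonneg_left (hDC μ hμ.1.1) (abs_nonneg t)
      have h3 := (abs_le.1 h2).1
      have h4 := hηD μ hμ (by nlinarith)
      have h5 := (abs_le.1 (hkey μ hμ h4)).1
      nlinarith
    refine (abs_div_sub_le (c := ε / 2) ht0 ?_).trans_lt (by linarith)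
    exact abs_le.2 ⟨hlow, hup⟩
  · rintro μ ⟨hμ, hμI⟩
    rw [hI, EReal.coe_eq_coe_iff] at hμI
    -- An equilibrium measure is a near-minimizer for every `η`.
    have hDμ : energyVariation V h μ = D := by
      refine eq_of_abs_sub_le_all fun ε hε => ?_
      obtain ⟨η, hη, hηD⟩ := hD ε hε
      exact hηD μ hμ (by linarith)
    refine ⟨mem_weightedMeasures_univ hμ, ?_, ?_⟩
    · filter_upwards [hsmall t₀ ht₀] with t ht
      obtain ⟨e, he, He⟩ := H t ht
      rw [← he]
      exact mem_weightedMeasures_univ ((He F μ).1.2 hμ)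
    · refine Metric.tendsto_nhds.2 fun ε hε => ?_
      filter_upwards [self_mem_nhdsWithin, nhdsWithin_le_nhds (hsmall t₀ ht₀),
        nhdsWithin_le_nhds (hsmall (ε / (2 * (C + 1))) (by positivity))] with t ht0 ht1 ht2
      have ht0 : t ≠ 0 := ht0
      have htp : 0 < |t| := abs_pos.2 ht0
      obtain ⟨e, he, He⟩ := H t ht1
      have h1 := (He F μ).2 hμ
      rw [hDμ] at h1
      rw [← he, Real.dist_eq]
      rw [le_div_iff₀ (by positivity)] at ht2
      refine (abs_div_sub_le (c := ε / 2) ht0 (h1.trans ?_)).trans_lt (by linarith)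
      rw [← sq_abs, sq]
      nlinarith

theorem proposition4p2 (V : Polynomial ℂ) (hV : 2 ≤ V.natDegree) :
    (∀ F : Set ℂ, IsClosed F → weightedSetEnergy V F ≠ ⊥ → weightedSetEnergy V F ≠ ⊤ →
      ∀ h : ℂ → ℂ, IsTestFunction h →
        ∃ D : ℝ, HasSetEnergyDeriv V h F D ∧
          ∀ μ : Measure ℂ, IsEquilibriumMeasure V F μ → HasMeasureEnergyDeriv V h μ D) ∧
    (∀ F : Set ℂ, IsCriticalSet V F →
      ∀ μ : Measure ℂ, IsEquilibriumMeasure V F μ → IsCriticalMeasure V μ) := by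
  refine ⟨fun F _ hbot htop h hh => exists_hasEnergyDeriv V hbot htop hh, ?_⟩
  rintro F ⟨-, hF⟩ μ hμ
  refine ⟨mem_weightedMeasures_univ hμ.1, fun h hh => ?_⟩
  obtain ⟨⟨hbot, htop⟩, -, h0⟩ := hF h hh
  obtain ⟨D, hD, hDμ⟩ := exists_hasEnergyDeriv V hbot htop hh
  -- Criticality of `F` forces the common derivative `D` to be `0`.
  rw [tendsto_nhds_unique h0 hD.2.2]
  exact hDμ μ hμ
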